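/- Let $\mathbb{M}_{n_1,n_2}$ be the space of real or complex $n_1\times n_2$ matrices with the Frobenius norm $\|\cdot\|$ and singular values $\sigma_1(X)\ge\sigma_2(X)\ge\dots\ge\sigma_n(X)\ge 0$, $n=\min(n_1,n_2)$. Let $\mathcal{A}$ be a (real-)linear operator from $\mathbb{M}_{n_1,n_2}$ to a finite-dimensional real inner product space (for instance $\mathbb{R}^m$, or $\mathbb{C}^m$ regarded as a real space), with operator norm $\|\mathcal{A}\|$. For $k\ge 1$ let the lower restricted isometry constant $\delta_k^-$ be defined by $$1-\delta_k^-=\inf\left\{\frac{\|\mathcal{A}X\|^2}{\|X\|^2} : X\neq 0,\ \operatorname{rank}(X)\le k\right\},$$ let $r_\mu(s)=\mu-\max(\sqrt{\mu}-s,0)^2$ for $\mu>0$, and put $$\mathcal{R}_{\mu,reg}(X)=\sum_{i=1}^n r_\mu(\sigma_i(X))+\|\mathcal{A}X-b\|^2,\qquad \mathcal{R}_\mu(X)=\mu\operatorname{rank}(X)+\|\mathcal{A}X-b\|^2 .$$ A matrix $X$ is called a stationary point of a functional $g$ if $$\liminf_{Y\to X,\ Y\neq X}\frac{g(Y)-g(X)}{\|Y-X\|}\ge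 0 .$$ Theorem. Let $b=\mathcal{A}X_0+\epsilon$, where $\|\mathcal{A}\|<1$ and $\operatorname{rank}(X_0)=K\ge 1$, let $\delta_{2K}^-<1$ and $\mu>0$, and assume that $$\|\epsilon\|\le\frac{(1-\delta_{2K}^-)^{3/2}\sqrt{\mu}}{3}\qquad\text{and}\qquad \sigma_K(X_0)>\left(\frac{1}{1-\delta_{2K}^-}+(1-\delta_{2K}^-)\right)\sqrt{\mu}.$$ Then the problem $\operatorname{argmin}_{\operatorname{rank}(X)\le K}\|\mathcal{A}X-b\|$ has a unique solution $X_B$, and $X_B$ is the unique global minimizer of $\mathcal{R}_{\mu,reg}$ as well as the unique global minimizer of $\mathcal{R}_\mu$. Moreover $$\|X_B-X_0\|\le\frac{2\|\epsilon\|}{\sqrt{1-\delta_{2K}^-}},$$ $X_B$ is a stationary point of $\mathcal{R}_{\mu,reg}$, and every other stationary point $X$ of $\mathcal{R}_{\mu,reg}$ satisfies $\operatorname{rank}(X)>K$. -/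

import Mathlib

open Filter Topology

attribute [local instance] Matrix.frobeniusNormedAddCommGroup Matrix.frobeniusNormedSpace

noncomputable section

/-- `singVal X j` is the `j`-th singular value `σ_j(X)`, `j = 1, 2, …`, in non-increasing order and
with multiplicity (Mathlib numbers the singular values from `0`). -/
def singVal {𝕜 : Type*} [RCLike 𝕜] {n₁ n₂ : ℕ} (X : Matrix (Fin n₁) (Fin n₂) 𝕜) (j : ℕ) : ℝ :=
  (Matrix.toEuclideanLin X).singularValues (j - 1)

/-- The operator norm of `A` with respect to the Frobenius norm on matrices: the least `c ≥ 0` with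
`‖A X‖ ≤ c ‖X‖_F` for all `X`. (The matrix norm in this file is Mathlib's Frobenius norm.) -/
def opNorm {𝕜 : Type*} [RCLike 𝕜] {n₁ n₂ : ℕ}
    {F : Type*} [NormedAddCommGroup F] [InnerProductSpace ℝ F]
    (A : Matrix (Fin n₁) (Fin n₂) 𝕜 →ₗ[ℝ] F) : ℝ :=
  sInf {c : ℝ | 0 ≤ c ∧ ∀ X : Matrix (Fin n₁) (Fin n₂) 𝕜, ‖A X‖ ≤ c * ‖X‖}

/-- The lower restricted isometry constant `δ_K⁻` of `A`, determined by
`1 - δ_K⁻ = inf { ‖A X‖² / ‖X‖_F² : X ≠ 0, rank X ≤ K }`. -/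
def lripConst {𝕜 : Type*} [RCLike 𝕜] {n₁ n₂ : ℕ}
    {F : Type*} [NormedAddCommGroup F] [InnerProductSpace ℝ F]
    (A : Matrix (Fin n₁) (Fin n₂) 𝕜 →ₗ[ℝ] F) (K : ℕ) : ℝ :=
  1 - sInf {q : ℝ | ∃ X : Matrix (Fin n₁) (Fin n₂) 𝕜, X ≠ 0 ∧ X.rank ≤ K ∧
    q = ‖A X‖ ^ 2 / ‖X‖ ^ 2}

/-- `r_μ(s) = μ - max(√μ - s, 0)²`. -/
def rMu (μ s : ℝ) : ℝ := μ - max (√μ - s) 0 ^ 2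

/-- `μ rank(X) + ‖A X - b‖²`. -/
def rankFunctional {𝕜 : Type*} [RCLike 𝕜] {n₁ n₂ : ℕ}
    {F : Type*} [NormedAddCommGroup F] [InnerProductSpace ℝ F]
    (A : Matrix (Fin n₁) (Fin n₂) 𝕜 →ₗ[ℝ] F) (b : F) (μ : ℝ)
    (X : Matrix (Fin n₁) (Fin n₂) 𝕜) : ℝ :=
  μ * (X.rank : ℝ) + ‖A X - b‖ ^ 2

/-- `∑ᵢ r_μ(σᵢ(X)) + ‖A X - b‖²`. -/
def regFunctional {𝕜 : Type*} [RCLike 𝕜] {n₁ n₂ : ℕ}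
    {F : Type*} [NormedAddCommGroup F] [InnerProductSpace ℝ F]
    (A : Matrix (Fin n₁) (Fin n₂) 𝕜 →ₗ[ℝ] F) (b : F) (μ : ℝ)
    (X : Matrix (Fin n₁) (Fin n₂) 𝕜) : ℝ :=
  (∑ i ∈ Finset.Icc 1 (min n₁ n₂), rMu μ (singVal X i)) + ‖A X - b‖ ^ 2

/-- The set of solutions of `argmin_{rank X ≤ K} ‖A X - b‖`. -/
def bestRankSolutions {𝕜 : Type*} [RCLike 𝕜] {n₁ n₂ : ℕ}
    {F : Type*} [NormedAddCommGroup F] [InnerProductSpace ℝ F]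
    (A : Matrix (Fin n₁) (Fin n₂) 𝕜 →ₗ[ℝ] F) (b : F) (K : ℕ) :
    Set (Matrix (Fin n₁) (Fin n₂) 𝕜) :=
  {X | X.rank ≤ K ∧ ∀ Y : Matrix (Fin n₁) (Fin n₂) 𝕜, Y.rank ≤ K → ‖A X - b‖ ≤ ‖A Y - b‖}

/-- The set of global minimizers of `g`. -/
def globalMinimizers {E : Type*} (g : E → ℝ) : Set E := {X | ∀ Y, g X ≤ g Y}

/-- `X` is stationary for `g` if `liminf_{Y → X, Y ≠ X} (g(Y) - g(X)) / ‖Y - X‖ ≥ 0`; the lower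
limit is taken in the extended reals. -/
def IsStationaryPt {E : Type*} [NormedAddCommGroup E] (g : E → ℝ) (X : E) : Prop :=
  0 ≤ liminf (fun Y => (((g Y - g X) / ‖Y - X‖ : ℝ) : EReal)) (𝓝[≠] X)

end

noncomputable section

/-! Write c = 1 - δ, with δ the lower restricted isometry constant for rank 2K. The function G(X) =
‖X‖² + ∑ r_μ(σᵢ(X)) is convex, with subgradient 2 ∑ max(√μ, yᵢ) uᵢvᵢ* at Y = ∑ yᵢ uᵢvᵢ*
(`spectral_subgradient`), and the regularized functional is G(X) - ‖X‖² + ‖AX - b‖². Let B be a best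
rank-K solution and E = A*(b - AB). The normal equations make E vanish on the singular vectors of B;
the noise and signal bounds make E small and the nonzero singular values of B large. This gap makes
the subgradients strongly monotone around B with modulus 1 - c' for some c' < c
(`strong_monotone_of_gap`). If X ≠ B has rank at most K, then X - B has rank at most 2K, so the
concave defect ‖AD‖² - ‖D‖² along D = X - B is at least -(1 - c)‖D‖². Strong monotonicity outweighs
it, so the functional decreases at a positive rate from X towards B and X is not stationary
(`IsStationaryPt.eq_of_best`).

Global minimality is a separate matter. Since ‖A‖ < 1, the regularized functional is strictly
concave in each singular value on [0, √μ], so such values can be pushed to an end point, where r_μ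
agrees with μ times the rank indicator (`rankFunctional_le_or_exists_lt`). Hence it suffices to
treat the rank functional, where ranks other than K are excluded by a direct estimate
(`lt_rankFunctional_of_rank_ne`). Global minimizers then have rank K and are stationary, so
uniqueness comes from the first part. -/

/-- The real inner product `Re tr(Xᴴ Y)` inducing the Frobenius norm. -/
abbrev frobeniusInnerProductSpace {𝕜 : Type*} [RCLike 𝕜] {n₁ n₂ : ℕ} :
    InnerProductSpace ℝ (Matrix (Fin n₁) (Fin n₂) 𝕜) where
  inner X Y := ∑ i, ∑ j, RCLike.re (starRingEnd 𝕜 (X i j) * Y i j)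
  norm_sq_eq_re_inner X := by
    have h : (0 : ℝ) ≤ ∑ i, ∑ j, ‖X i j‖ ^ (2 : ℝ) := by positivity
    rw [Matrix.frobenius_norm_def, ← Real.sqrt_eq_rpow, Real.sq_sqrt h]
    rw [RCLike.re_to_real]
    refine Finset.sum_congr rfl fun i _ => ?_
    refine Finset.sum_congr rfl fun j _ => ?_
    rw [RCLike.conj_mul, ← RCLike.ofReal_pow, RCLike.ofReal_re, Real.rpow_two]
  conj_inner_symm X Y := by
    simp only [conj_trivial]
    refine Finset.sum_congr rfl fun i _ => Finset.sum_congr rfl fun j _ => ?_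
    rw [← RCLike.conj_re, map_mul, RCLike.conj_conj, mul_comm]
  add_left X Y Z := by
    simp [add_mul, Finset.sum_add_distrib]
  smul_left X Y r := by
    simp only [Matrix.smul_apply, RCLike.real_smul_eq_coe_mul, map_mul, RCLike.conj_ofReal,
      conj_trivial, Finset.mul_sum, mul_assoc, RCLike.re_ofReal_mul]

attribute [local instance] frobeniusInnerProductSpace

section SVD

variable {𝕜 : Type*} [RCLike 𝕜] {n₁ n₂ : ℕ} {ι κ : Type*} [Fintype ι] [Fintype κ]

local notation "⟪" x "," y "⟫" => inner 𝕜 x y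

/-! ### Rank-one matrices and their Frobenius inner products. -/

/-- The rank-one matrix `p q*`. -/
def outer (p : EuclideanSpace 𝕜 (Fin n₁)) (q : EuclideanSpace 𝕜 (Fin n₂)) :
    Matrix (Fin n₁) (Fin n₂) 𝕜 :=
  Matrix.vecMulVec p (star q)

theorem toEuclideanLin_outer (p : EuclideanSpace 𝕜 (Fin n₁)) (q x : EuclideanSpace 𝕜 (Fin n₂)) :
    Matrix.toEuclideanLin (outer p q) x = ⟪q, x⟫ • p := by
  ext i
  simp only [outer, Matrix.toLpLin_apply, Matrix.mulVec, dotProduct, Matrix.vecMulVec_apply,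
    PiLp.inner_apply, PiLp.smul_apply, smul_eq_mul, Finset.sum_mul, RCLike.inner_apply]
  refine Finset.sum_congr rfl fun j _ => ?_
  simp [mul_comm, mul_left_comm]

theorem toEuclideanLin_smul_outer (r : ℝ) (p : EuclideanSpace 𝕜 (Fin n₁))
    (q x : EuclideanSpace 𝕜 (Fin n₂)) :
    Matrix.toEuclideanLin (r • outer p q) x = (r : 𝕜) • ⟪q, x⟫ • p := by
  rw [RCLike.real_smul_eq_coe_smul (K := 𝕜), map_smul, LinearMap.smul_apply, toEuclideanLin_outer]

theorem inner_outer_left (p : EuclideanSpace 𝕜 (Fin n₁)) (q : EuclideanSpace 𝕜 (Fin n₂))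
    (X : Matrix (Fin n₁) (Fin n₂) 𝕜) :
    inner ℝ (outer p q) X = RCLike.re ⟪p, Matrix.toEuclideanLin X q⟫ := by
  change ∑ i, ∑ j, RCLike.re (starRingEnd 𝕜 (outer p q i j) * X i j) = _
  simp only [PiLp.inner_apply, RCLike.inner_apply, map_sum]
  refine Finset.sum_congr rfl fun i _ => ?_
  rw [← map_sum]
  congr 1
  simp only [Matrix.toLpLin_apply, Matrix.mulVec, dotProduct, Finset.sum_mul]
  refine Finset.sum_congr rfl fun j _ => ?_
  simp only [outer, Matrix.vecMulVec_apply, Pi.star_apply, map_mul, RCLike.star_def,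
    RCLike.conj_conj]
  ring

theorem inner_outer_outer (p p' : EuclideanSpace 𝕜 (Fin n₁)) (q q' : EuclideanSpace 𝕜 (Fin n₂)) :
    inner ℝ (outer p q) (outer p' q') = RCLike.re (⟪p, p'⟫ * ⟪q', q⟫) := by
  rw [inner_outer_left, toEuclideanLin_outer, inner_smul_right, mul_comm]

theorem norm_outer (p : EuclideanSpace 𝕜 (Fin n₁)) (q : EuclideanSpace 𝕜 (Fin n₂)) :
    ‖outer p q‖ = ‖p‖ * ‖q‖ := by
  have h : ‖outer p q‖ ^ 2 = (‖p‖ * ‖q‖) ^ 2 := by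
    rw [← real_inner_self_eq_norm_sq, inner_outer_outer, inner_self_eq_norm_sq_to_K,
      inner_self_eq_norm_sq_to_K]
    norm_cast
    ring
  exact (sq_eq_sq₀ (norm_nonneg _) (by positivity)).1 h

theorem rank_outer_le (p : EuclideanSpace 𝕜 (Fin n₁)) (q : EuclideanSpace 𝕜 (Fin n₂)) :
    (outer p q).rank ≤ 1 :=
  Matrix.rank_vecMulVec_le _ _

/-! ### Singular value decompositions over one common index type. -/

/-- An orthonormal basis, padded by zero vectors. -/
structure IsPaddedBasis {E : Type*} [NormedAddCommGroup E] [InnerProductSpace 𝕜 E]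
    (u : ι → E) : Prop where
  orthogonal : ∀ i j, i ≠ j → ⟪u i, u j⟫ = 0
  parseval : ∀ p, ∑ i, ‖⟪u i, p⟫‖ ^ 2 = ‖p‖ ^ 2

/-- `X = ∑ᵢ xᵢ uᵢ vᵢ*` is a singular value decomposition, the singular values in any order. -/
structure IsSVD (X : Matrix (Fin n₁) (Fin n₂) 𝕜) (u : ι → EuclideanSpace 𝕜 (Fin n₁))
    (v : ι → EuclideanSpace 𝕜 (Fin n₂)) (x : ι → ℝ) : Prop where
  left : IsPaddedBasis (𝕜 := 𝕜) u
  right : IsPaddedBasis (𝕜 := 𝕜) v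
  nonneg : ∀ i, 0 ≤ x i
  norm_left : ∀ i, x i ≠ 0 → ‖u i‖ = 1
  norm_right : ∀ i, x i ≠ 0 → ‖v i‖ = 1
  eq_sum : X = ∑ i, x i • outer (u i) (v i)

theorem IsPaddedBasis.norm_le_one {E : Type*} [NormedAddCommGroup E] [InnerProductSpace 𝕜 E]
    {u : ι → E} (hu : IsPaddedBasis (𝕜 := 𝕜) u) (i : ι) : ‖u i‖ ≤ 1 := by
  have h := Finset.single_le_sum (f := fun j => ‖⟪u j, u i⟫‖ ^ 2) (fun j _ => by positivity)
    (Finset.mem_univ i)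
  rw [hu.parseval, inner_self_eq_norm_sq_to_K] at h
  simp only [norm_pow, RCLike.norm_ofReal, abs_norm] at h
  by_contra! hlt
  have h2 : 1 < ‖u i‖ ^ 2 := one_lt_pow₀ hlt two_ne_zero
  nlinarith

/-- Orthonormal bases padded by zeros form a padded basis. -/
theorem OrthonormalBasis.isPaddedBasis {E : Type*} [NormedAddCommGroup E] [InnerProductSpace 𝕜 E]
    {n N : ℕ} (hn : n ≤ N) (b : OrthonormalBasis (Fin n) 𝕜 E) :
    IsPaddedBasis (𝕜 := 𝕜) (fun i : Fin N => if h : (i : ℕ) < n then b ⟨i, h⟩ else 0) where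
  orthogonal i j hij := by
    by_cases hi : (i : ℕ) < n <;> by_cases hj : (j : ℕ) < n <;> simp only [hi, hj, dif_pos,
      dif_neg, not_false_iff, inner_zero_left, inner_zero_right]
    exact b.orthonormal.2 (by simpa [Fin.ext_iff] using hij)
  parseval p := by
    rw [← b.sum_sq_norm_inner_right]
    symm
    apply Finset.sum_of_injOn (Fin.castLE hn) (fun _ _ _ _ h => Fin.castLE_injective hn h)
      (by simp)
    · intro i _ hi
      have : ¬ (i : ℕ) < n := fun h => hi ⟨⟨i, h⟩, by simp, by simp⟩
      simp [this]
    · intro i _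
      simp

theorem rank_eq_finrank_range (X : Matrix (Fin n₁) (Fin n₂) 𝕜) :
    X.rank = Module.finrank 𝕜 (LinearMap.range (Matrix.toEuclideanLin X)) := by
  rw [Matrix.rank_eq_finrank_range_toLin X (EuclideanSpace.basisFun (Fin n₁) 𝕜).toBasis
    (EuclideanSpace.basisFun (Fin n₂) 𝕜).toBasis, Matrix.toEuclideanLin_eq_toLin_orthonormal]

theorem singularValues_eq_zero_iff_rank_le (X : Matrix (Fin n₁) (Fin n₂) 𝕜) (i : ℕ) :
    (Matrix.toEuclideanLin X).singularValues i = 0 ↔ X.rank ≤ i := by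
  rw [LinearMap.singularValues_eq_zero_iff_le_finrank_range, rank_eq_finrank_range]

theorem exists_isSVD (X : Matrix (Fin n₁) (Fin n₂) 𝕜) :
    ∃ (u : Fin (n₁ + n₂) → EuclideanSpace 𝕜 (Fin n₁))
      (v : Fin (n₁ + n₂) → EuclideanSpace 𝕜 (Fin n₂)),
      IsSVD X u v (fun i => (Matrix.toEuclideanLin X).singularValues i) := by
  set T := Matrix.toEuclideanLin X with hT
  have hs := T.isSymmetric_adjoint_comp_self
  set b := hs.eigenvectorBasis (finrank_euclideanSpace_fin (𝕜 := 𝕜) (n := n₂)) with hb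
  have hinner : ∀ i j, ⟪T (b i), T (b j)⟫ =
      ((T.singularValues j ^ 2 : ℝ) : 𝕜) * ⟪b i, b j⟫ := by
    intro i j
    rw [← LinearMap.adjoint_inner_right, ← LinearMap.comp_apply, hs.apply_eigenvectorBasis,
      inner_smul_right, ← T.sq_singularValues_fin]
  -- The left singular vectors are T bᵢ / σᵢ. Only indices with σᵢ ≠ 0 matter: the extension to a
  -- basis below replaces the other values.
  set f : Fin n₁ → EuclideanSpace 𝕜 (Fin n₁) := fun i =>
    if h : (i : ℕ) < n₂ then ((T.singularValues i : 𝕜))⁻¹ • T (b ⟨i, h⟩) else 0 with hf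
  set s : Set (Fin n₁) := {i | T.singularValues i ≠ 0} with hsdef
  have hr1 : ∀ i, T.singularValues i ≠ 0 → i < n₁ := fun i hi => by
    have := X.rank_le_height
    rw [Ne, singularValues_eq_zero_iff_rank_le] at hi
    omega
  have hr2 : ∀ i, T.singularValues i ≠ 0 → i < n₂ := fun i hi => by
    have := X.rank_le_width
    rw [Ne, singularValues_eq_zero_iff_rank_le] at hi
    omega
  have horth : Orthonormal 𝕜 (s.domRestrict f) := by
    rw [orthonormal_iff_ite]
    rintro ⟨i, hi⟩ ⟨j, hj⟩
    have hi2 := hr2 _ hi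
    have hj2 := hr2 _ hj
    rw [Set.domRestrict_apply, Set.domRestrict_apply]
    simp only [hf, hi2, hj2, dif_pos, inner_smul_left, inner_smul_right, hinner,
      orthonormal_iff_ite.1 b.orthonormal, Fin.mk.injEq, Subtype.mk.injEq]
    by_cases hij : i = j
    · subst hij
      have : ((T.singularValues i : ℝ) : 𝕜) ≠ 0 := by exact_mod_cast hi
      simp only [if_true, map_inv₀, RCLike.conj_ofReal, RCLike.ofReal_pow, mul_one]
      field_simp
    · have : ¬ (i : ℕ) = j := fun h => hij (Fin.ext h)
      simp [hij, this]
  obtain ⟨c, hc⟩ := horth.exists_orthonormalBasis_extension_of_card_eq (ι := Fin n₁)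
    (by simp)
  refine ⟨fun i => if h : (i : ℕ) < n₁ then c ⟨i, h⟩ else 0,
    fun i => if h : (i : ℕ) < n₂ then b ⟨i, h⟩ else 0,
    c.isPaddedBasis (Nat.le_add_right _ _), b.isPaddedBasis (Nat.le_add_left _ _),
    fun i => T.singularValues_nonneg i, fun i hi => ?_, fun i hi => ?_, ?_⟩
  · simp [hr1 _ hi]
  · simp [hr2 _ hi]
  · apply Matrix.toEuclideanLin.injective
    refine b.toBasis.ext fun j => ?_
    rw [OrthonormalBasis.coe_toBasis, ← hT]
    simp only [map_sum, LinearMap.sum_apply]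
    rw [Finset.sum_eq_single (⟨j, by omega⟩ : Fin (n₁ + n₂))]
    · by_cases hj : T.singularValues j = 0
      · have h0 := hinner j j
        rw [hj] at h0
        simp only [RCLike.ofReal_zero, zero_mul, ne_eq, OfNat.ofNat_ne_zero, not_false_eq_true,
          zero_pow, inner_self_eq_zero] at h0
        simp [hj, h0]
      · have h1 := hc ⟨j, hr1 _ hj⟩ hj
        have : ((T.singularValues j : ℝ) : 𝕜) ≠ 0 := by exact_mod_cast hj
        simp [toEuclideanLin_smul_outer, hr1 _ hj, h1, hf, smul_smul, this]
    · intro i _ hij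
      have hne : ¬ (i : ℕ) = j := fun h => hij (Fin.ext h)
      rw [toEuclideanLin_smul_outer]
      by_cases hi : (i : ℕ) < n₂
      · have : ⟪b ⟨i, hi⟩, b j⟫ = 0 := b.orthonormal.2 (by simpa [Fin.ext_iff] using hne)
        simp [hi, this]
      · simp [hi]
    · simp

/-! ### Overlap weights: reducing matrix inequalities to scalar ones. -/

/-- The mean of the squared overlaps of two left and two right singular vectors. -/
def overlap (u p : EuclideanSpace 𝕜 (Fin n₁)) (v q : EuclideanSpace 𝕜 (Fin n₂)) : ℝ :=
  (‖⟪u, p⟫‖ ^ 2 + ‖⟪v, q⟫‖ ^ 2) / 2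

theorem overlap_nonneg (u p : EuclideanSpace 𝕜 (Fin n₁)) (v q : EuclideanSpace 𝕜 (Fin n₂)) :
    0 ≤ overlap u p v q := by
  unfold overlap; positivity

theorem overlap_comm (u p : EuclideanSpace 𝕜 (Fin n₁)) (v q : EuclideanSpace 𝕜 (Fin n₂)) :
    overlap u p v q = overlap p u q v := by
  unfold overlap; rw [norm_inner_symm u, norm_inner_symm v]

/-- This is AM-GM. It plays the role of von Neumann's trace inequality, without any ordering of the
singular values. -/
theorem inner_outer_le_overlap (u p : EuclideanSpace 𝕜 (Fin n₁))
    (v q : EuclideanSpace 𝕜 (Fin n₂)) :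
    inner ℝ (outer u v) (outer p q) ≤ overlap u p v q := by
  rw [inner_outer_outer]
  refine (RCLike.re_le_norm _).trans ?_
  rw [norm_mul, norm_inner_symm q, overlap]
  nlinarith [sq_nonneg (‖⟪u, p⟫‖ - ‖⟪v, q⟫‖)]

theorem sum_overlap {p : κ → EuclideanSpace 𝕜 (Fin n₁)} {q : κ → EuclideanSpace 𝕜 (Fin n₂)}
    (hp : IsPaddedBasis (𝕜 := 𝕜) p) (hq : IsPaddedBasis (𝕜 := 𝕜) q)
    (u : EuclideanSpace 𝕜 (Fin n₁)) (v : EuclideanSpace 𝕜 (Fin n₂)) :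
    ∑ j, overlap u (p j) v (q j) = (‖u‖ ^ 2 + ‖v‖ ^ 2) / 2 := by
  simp only [overlap, ← Finset.sum_div, Finset.sum_add_distrib]
  rw [← hp.parseval u, ← hq.parseval v]
  simp only [norm_inner_symm u, norm_inner_symm v]

section TwoDecompositions

variable {X Y : Matrix (Fin n₁) (Fin n₂) 𝕜}
  {u : ι → EuclideanSpace 𝕜 (Fin n₁)} {v : ι → EuclideanSpace 𝕜 (Fin n₂)} {y : ι → ℝ}
  {p : κ → EuclideanSpace 𝕜 (Fin n₁)} {q : κ → EuclideanSpace 𝕜 (Fin n₂)} {x : κ → ℝ}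

/-- Parseval gives each row total weight 1 when yᵢ ≠ 0; padding vectors may give less, hence the
condition on f. Single sums thus become double sums, comparable pair by pair. -/
theorem sum_eq_sum_overlap_left (hY : IsSVD Y u v y) (hX : IsSVD X p q x) (f : ι → ℝ)
    (hf : ∀ i, y i = 0 → f i = 0) :
    ∑ i, f i = ∑ i, ∑ j, overlap (u i) (p j) (v i) (q j) * f i := by
  refine Finset.sum_congr rfl fun i _ => ?_
  rw [← Finset.sum_mul, sum_overlap hX.left hX.right]
  by_cases h : y i = 0
  · simp [hf i h]
  · simp [hY.norm_left i h, hY.norm_right i h]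

theorem sum_eq_sum_overlap_right (hY : IsSVD Y u v y) (hX : IsSVD X p q x) (f : κ → ℝ)
    (hf : ∀ j, x j = 0 → f j = 0) :
    ∑ j, f j = ∑ i, ∑ j, overlap (u i) (p j) (v i) (q j) * f j := by
  rw [Finset.sum_comm, sum_eq_sum_overlap_left hX hY f hf]
  exact Finset.sum_congr rfl fun j _ => Finset.sum_congr rfl fun i _ => by rw [overlap_comm]

theorem IsSVD.inner_sum_smul (hY : IsSVD Y u v y) (w : ι → ℝ) :
    inner ℝ (∑ i, w i • outer (u i) (v i)) Y = ∑ i, w i * y i := by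
  conv_lhs => rw [hY.eq_sum]
  simp only [sum_inner, inner_sum, real_inner_smul_left, real_inner_smul_right]
  refine Finset.sum_congr rfl fun i _ => ?_
  rw [Finset.sum_eq_single i]
  · by_cases h : y i = 0
    · simp [h]
    · rw [real_inner_self_eq_norm_sq, norm_outer, hY.norm_left i h, hY.norm_right i h]
      ring
  · intro j _ hj
    rw [inner_outer_outer, hY.left.orthogonal j i hj]
    simp
  · simp

theorem IsSVD.norm_sq (hY : IsSVD Y u v y) : ‖Y‖ ^ 2 = ∑ i, y i ^ 2 := by
  have h := hY.inner_sum_smul y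
  rw [← hY.eq_sum, real_inner_self_eq_norm_sq] at h
  simpa only [sq] using h

theorem IsSVD.inner_sum_smul_right (hX : IsSVD X p q x) (w : ι → ℝ) :
    inner ℝ (∑ i, w i • outer (u i) (v i)) X =
      ∑ i, ∑ j, inner ℝ (outer (u i) (v i)) (outer (p j) (q j)) * (w i * x j) := by
  conv_lhs => rw [hX.eq_sum]
  simp only [sum_inner, inner_sum, real_inner_smul_left, real_inner_smul_right]
  rw [Finset.sum_comm]
  exact Finset.sum_congr rfl fun i _ => Finset.sum_congr rfl fun j _ => by ring

theorem sum_inner_outer_mul_le (C : ι → κ → ℝ) (hC : ∀ i j, 0 ≤ C i j) :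
    ∑ i, ∑ j, inner ℝ (outer (u i) (v i)) (outer (p j) (q j)) * C i j ≤
      ∑ i, ∑ j, overlap (u i) (p j) (v i) (q j) * C i j := by
  gcongr with i _ j _
  · exact hC i j
  · exact inner_outer_le_overlap _ _ _ _

/-! ### Convexity of the quadratically corrected regularizer. -/

theorem rMu_zero {μ : ℝ} (hμ : 0 < μ) : rMu μ 0 = 0 := by
  simp [rMu, Real.sq_sqrt hμ.le]

theorem rMu_of_sqrt_le {μ s : ℝ} (h : √μ ≤ s) : rMu μ s = μ := by
  rw [rMu, max_eq_right (by linarith)]; ring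

theorem rMu_of_le_sqrt {μ s : ℝ} (hμ : 0 < μ) (h : s ≤ √μ) :
    rMu μ s = 2 * √μ * s - s ^ 2 := by
  rw [rMu, max_eq_left (by linarith)]
  nlinarith [Real.sq_sqrt hμ.le]

/-- The function s² + r_μ(s) is 2√μ s up to √μ and s² + μ beyond, hence convex with derivative 2
max(√μ, s). -/
theorem sq_add_rMu_subgradient {μ x y : ℝ} (hμ : 0 < μ) :
    y ^ 2 + rMu μ y - 2 * (max (√μ) y * y) + 2 * (max (√μ) y * x) ≤ x ^ 2 + rMu μ x := by
  have hs := Real.sq_sqrt hμ.le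
  have hs0 := Real.sqrt_nonneg μ
  rcases le_total y (√μ) with hy | hy <;> rcases le_total x (√μ) with hx' | hx'
  · rw [rMu_of_le_sqrt hμ hy, rMu_of_le_sqrt hμ hx', max_eq_left hy]
    nlinarith
  · rw [rMu_of_le_sqrt hμ hy, rMu_of_sqrt_le hx', max_eq_left hy]
    nlinarith [sq_nonneg (x - √μ)]
  · rw [rMu_of_sqrt_le hy, rMu_of_le_sqrt hμ hx', max_eq_right hy]
    nlinarith [mul_nonneg (sub_nonneg.2 hy) (sub_nonneg.2 hx'), sq_nonneg (y - √μ)]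
  · rw [rMu_of_sqrt_le hy, rMu_of_sqrt_le hx', max_eq_right hy]
    nlinarith [sq_nonneg (x - y)]

/-- The explicit subgradient `2 ∑ᵢ max(√μ, yᵢ) uᵢ vᵢ*` at `Y` of the convex spectral function
`X ↦ ‖X‖² + ∑ᵢ r_μ(σᵢ(X))`. -/
theorem spectral_subgradient {μ : ℝ} (hμ : 0 < μ) (hY : IsSVD Y u v y) (hX : IsSVD X p q x) :
    ‖Y‖ ^ 2 + ∑ i, rMu μ (y i) +
        2 * inner ℝ (∑ i, max (√μ) (y i) • outer (u i) (v i)) (X - Y) ≤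
      ‖X‖ ^ 2 + ∑ j, rMu μ (x j) := by
  have hw : ∀ i, 0 ≤ max (√μ) (y i) := fun i => (Real.sqrt_nonneg μ).trans (le_max_left _ _)
  have h1 := sum_eq_sum_overlap_left hY hX
    (fun i => y i ^ 2 + rMu μ (y i) - 2 * (max (√μ) (y i) * y i))
    (fun i hi => by simp [hi, rMu_zero hμ])
  have h2 := sum_eq_sum_overlap_right hY hX (fun j => x j ^ 2 + rMu μ (x j))
    (fun j hj => by simp [hj, rMu_zero hμ])
  have h3 := sum_inner_outer_mul_le (u := u) (v := v) (p := p) (q := q)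
    (fun i j => max (√μ) (y i) * x j) (fun i j => mul_nonneg (hw i) (hX.nonneg j))
  have h4 : ∑ i, ∑ j, overlap (u i) (p j) (v i) (q j) *
        (y i ^ 2 + rMu μ (y i) - 2 * (max (√μ) (y i) * y i)) +
      2 * ∑ i, ∑ j, overlap (u i) (p j) (v i) (q j) * (max (√μ) (y i) * x j) ≤
      ∑ i, ∑ j, overlap (u i) (p j) (v i) (q j) * (x j ^ 2 + rMu μ (x j)) := by
    simp only [Finset.mul_sum, ← Finset.sum_add_distrib]
    refine Finset.sum_le_sum fun i _ => Finset.sum_le_sum fun j _ => ?_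
    have := mul_le_mul_of_nonneg_left (sq_add_rMu_subgradient (x := x j) (y := y i) hμ)
      (overlap_nonneg (u i) (p j) (v i) (q j))
    linarith
  rw [inner_sub_right, hY.inner_sum_smul, hX.inner_sum_smul_right, hY.norm_sq, hX.norm_sq]
  rw [← h1, ← h2] at h4
  simp only [Finset.sum_add_distrib, Finset.sum_sub_distrib, ← Finset.mul_sum] at h4
  linarith

/-! ### Strong monotonicity under a spectral gap. -/

theorem IsPaddedBasis.norm_sq_residual {E : Type*} [NormedAddCommGroup E] [InnerProductSpace 𝕜 E]
    [DecidableEq κ] {e : κ → E} (he : IsPaddedBasis (𝕜 := 𝕜) e) (s : Finset κ) (hs : ∀ j ∈ s, ‖e j‖ = 1) (r : E) :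
    ‖r - ∑ j ∈ s, ⟪e j, r⟫ • e j‖ ^ 2 = ∑ j, if j ∈ s then 0 else ‖⟪e j, r⟫‖ ^ 2 := by
  rw [← he.parseval]
  refine Finset.sum_congr rfl fun j _ => ?_
  rw [inner_sub_right, inner_sum]
  simp only [inner_smul_right]
  split_ifs with hj
  · rw [Finset.sum_eq_single j]
    · simp [inner_self_eq_norm_sq_to_K, hs j hj]
    · intro k _ hk
      rw [he.orthogonal j k hk.symm, mul_zero]
    · exact fun h => absurd hj h
  · rw [Finset.sum_eq_zero, sub_zero]
    intro k hk
    rw [he.orthogonal j k (fun h => hj (h ▸ hk)), mul_zero]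

/-- E sees only the components of r and s orthogonal to the singular vectors with xⱼ ≠ 0. Bounding
the product of their norms by the mean of squares leaves exactly the overlaps with xⱼ = 0. -/
theorem re_inner_le_of_vanishing (hX : IsSVD X p q x) {E : Matrix (Fin n₁) (Fin n₂) 𝕜} {e : ℝ}
    (he : 0 ≤ e)
    (hE : ∀ r s, RCLike.re ⟪r, Matrix.toEuclideanLin E s⟫ ≤ e * (‖r‖ * ‖s‖))
    (hl : ∀ j, x j ≠ 0 → ∀ s, ⟪p j, Matrix.toEuclideanLin E s⟫ = 0)
    (hr : ∀ j, x j ≠ 0 → Matrix.toEuclideanLin E (q j) = 0)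
    (r : EuclideanSpace 𝕜 (Fin n₁)) (s : EuclideanSpace 𝕜 (Fin n₂)) :
    RCLike.re ⟪r, Matrix.toEuclideanLin E s⟫ ≤
      ∑ j, overlap r (p j) s (q j) * (if x j = 0 then e else 0) := by
  classical
  set S := Finset.univ.filter fun j => x j ≠ 0 with hS
  have hSm : ∀ j, j ∈ S ↔ x j ≠ 0 := by simp [hS]
  have h1 := hX.left.norm_sq_residual S (fun j hj => hX.norm_left j ((hSm j).1 hj)) r
  have h2 := hX.right.norm_sq_residual S (fun j hj => hX.norm_right j ((hSm j).1 hj)) s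
  have h3 := hE (r - ∑ j ∈ S, ⟪p j, r⟫ • p j) (s - ∑ j ∈ S, ⟪q j, s⟫ • q j)
  have h4 : Matrix.toEuclideanLin E (s - ∑ j ∈ S, ⟪q j, s⟫ • q j) = Matrix.toEuclideanLin E s := by
    rw [map_sub, map_sum, Finset.sum_eq_zero, sub_zero]
    intro j hj
    rw [map_smul, hr j ((hSm j).1 hj), smul_zero]
  have h5 : ⟪r - ∑ j ∈ S, ⟪p j, r⟫ • p j, Matrix.toEuclideanLin E s⟫ =
      ⟪r, Matrix.toEuclideanLin E s⟫ := by
    rw [inner_sub_left, sum_inner, Finset.sum_eq_zero, sub_zero]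
    intro j hj
    rw [inner_smul_left, hl j ((hSm j).1 hj), mul_zero]
  rw [h4, h5] at h3
  refine h3.trans ?_
  have h6 : ∑ j, overlap r (p j) s (q j) * (if x j = 0 then e else 0) =
      e * (((∑ j, if j ∈ S then 0 else ‖⟪p j, r⟫‖ ^ 2) +
        ∑ j, if j ∈ S then 0 else ‖⟪q j, s⟫‖ ^ 2) / 2) := by
    rw [← Finset.sum_add_distrib, Finset.sum_div, Finset.mul_sum]
    refine Finset.sum_congr rfl fun j _ => ?_
    by_cases hj : x j = 0
    · simp [hSm, hj, overlap, norm_inner_symm r, norm_inner_symm s, mul_comm]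
    · simp [hSm, hj]
  rw [h6, ← h1, ← h2]
  gcongr
  nlinarith [sq_nonneg (‖r - ∑ j ∈ S, ⟪p j, r⟫ • p j‖ - ‖s - ∑ j ∈ S, ⟪q j, s⟫ • q j‖)]

theorem gap_scalar_inequality {a c e x y : ℝ} (hc : 0 < c) (hc1 : c < 1) (ha : 0 < a)
    (hy : 0 ≤ y) (he : e ≤ c * a) (hx : x = 0 ∨ a ≤ c * x) :
    (1 - c) * (y - x) ^ 2 ≤
      max a y * y - (max a y + y) * x + x ^ 2 - (if x = 0 then e else 0) * y := by
  rcases hx with rfl | hx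
  · rw [if_pos rfl]
    rcases le_total y a with h | h
    · rw [max_eq_left h]
      nlinarith [mul_nonneg hy (sub_nonneg.2 h), mul_nonneg hy (sub_nonneg.2 he)]
    · rw [max_eq_right h]
      nlinarith [mul_nonneg hy (sub_nonneg.2 h), mul_nonneg hy (sub_nonneg.2 he)]
  · have hx0 : 0 < x := pos_of_mul_pos_right (ha.trans_le hx) hc.le
    rw [if_neg hx0.ne']
    rcases le_total y a with h | h
    · rw [max_eq_left h]
      have hxa : a ≤ x := hx.trans (by nlinarith)
      have : 0 ≤ (x - y) * (c * x - a + (1 - c) * y) :=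
        mul_nonneg (by linarith) (by nlinarith)
      nlinarith
    · rw [max_eq_right h]
      nlinarith [sq_nonneg (y - x)]

/-- Strong monotonicity of the subgradients around a matrix whose subgradient `X + E` has a gap
in its singular values. -/
theorem strong_monotone_of_gap {μ c e : ℝ} (hμ : 0 < μ) (hc : 0 < c) (hc1 : c < 1)
    (he : 0 ≤ e) (hec : e ≤ c * √μ) (hY : IsSVD Y u v y) (hX : IsSVD X p q x)
    (hgap : ∀ j, x j = 0 ∨ √μ ≤ c * x j) {E : Matrix (Fin n₁) (Fin n₂) 𝕜}
    (hE : ∀ r s, RCLike.re ⟪r, Matrix.toEuclideanLin E s⟫ ≤ e * (‖r‖ * ‖s‖))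
    (hl : ∀ j, x j ≠ 0 → ∀ s, ⟪p j, Matrix.toEuclideanLin E s⟫ = 0)
    (hr : ∀ j, x j ≠ 0 → Matrix.toEuclideanLin E (q j) = 0) :
    (1 - c) * ‖Y - X‖ ^ 2 ≤
      inner ℝ (∑ i, max (√μ) (y i) • outer (u i) (v i) - (X + E)) (Y - X) := by
  have hμ' : 0 < √μ := Real.sqrt_pos.2 hμ
  have hEX : inner ℝ E X = 0 := by
    rw [real_inner_comm, hX.eq_sum, sum_inner]
    refine Finset.sum_eq_zero fun j _ => ?_
    rw [real_inner_smul_left, inner_outer_left]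
    by_cases hj : x j = 0
    · simp [hj]
    · rw [hl j hj]; simp
  have hEY : inner ℝ E Y ≤ ∑ i, ∑ j, overlap (u i) (p j) (v i) (q j) *
      ((if x j = 0 then e else 0) * y i) := by
    rw [real_inner_comm, hY.eq_sum, sum_inner]
    refine Finset.sum_le_sum fun i _ => ?_
    rw [real_inner_smul_left, inner_outer_left]
    refine (mul_le_mul_of_nonneg_left (re_inner_le_of_vanishing hX he hE hl hr (u i) (v i))
      (hY.nonneg i)).trans_eq ?_
    rw [Finset.mul_sum]
    exact Finset.sum_congr rfl fun j _ => by ring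
  have h1 := sum_eq_sum_overlap_left hY hX (fun i => max (√μ) (y i) * y i - (1 - c) * y i ^ 2)
    (fun i hi => by simp [hi])
  have h2 := sum_eq_sum_overlap_right hY hX (fun j => c * x j ^ 2) (fun j hj => by simp [hj])
  -- All cross terms are collected first: (max(√μ, y) + y)x minus 2(1 - c)yx. The combined
  -- coefficient is nonnegative, as the overlap bound requires.
  have h3 := sum_inner_outer_mul_le (u := u) (v := v) (p := p) (q := q)
    (fun i j => (max (√μ) (y i) - y i + 2 * c * y i) * x j)
    (fun i j => mul_nonneg (by nlinarith [le_max_right (√μ) (y i), hY.nonneg i]) (hX.nonneg j))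
  have hYX := hX.inner_sum_smul_right (u := u) (v := v) y
  rw [← hY.eq_sum] at hYX
  have hWX := hX.inner_sum_smul_right (u := u) (v := v) (fun i => max (√μ) (y i))
  have hM : inner ℝ (∑ i, max (√μ) (y i) • outer (u i) (v i)) X - (1 - 2 * c) * inner ℝ Y X =
      ∑ i, ∑ j, inner ℝ (outer (u i) (v i)) (outer (p j) (q j)) *
        ((max (√μ) (y i) - y i + 2 * c * y i) * x j) := by
    rw [hWX, hYX]
    simp only [Finset.mul_sum, ← Finset.sum_sub_distrib]
    exact Finset.sum_congr rfl fun i _ => Finset.sum_congr rfl fun j _ => by ring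
  have h4 : 0 ≤ ∑ i, ∑ j, overlap (u i) (p j) (v i) (q j) *
        (max (√μ) (y i) * y i - (1 - c) * y i ^ 2) +
      ∑ i, ∑ j, overlap (u i) (p j) (v i) (q j) * (c * x j ^ 2) -
      ∑ i, ∑ j, overlap (u i) (p j) (v i) (q j) *
        ((max (√μ) (y i) - y i + 2 * c * y i) * x j) -
      ∑ i, ∑ j, overlap (u i) (p j) (v i) (q j) * ((if x j = 0 then e else 0) * y i) := by
    simp only [← Finset.sum_sub_distrib, ← Finset.sum_add_distrib]
    refine Finset.sum_nonneg fun i _ => Finset.sum_nonneg fun j _ => ?_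
    have := mul_le_mul_of_nonneg_left (gap_scalar_inequality hc hc1 hμ' (hY.nonneg i) hec (hgap j))
      (overlap_nonneg (u i) (p j) (v i) (q j))
    linarith
  rw [← h1, ← h2] at h4
  simp only [Finset.sum_sub_distrib, ← Finset.mul_sum] at h4
  rw [← hY.norm_sq, ← hX.norm_sq, ← hY.inner_sum_smul] at h4
  have hsq : ‖Y - X‖ ^ 2 = ‖Y‖ ^ 2 - 2 * inner ℝ Y X + ‖X‖ ^ 2 := by
    rw [norm_sub_sq_real]
  rw [hsq, inner_sub_left, inner_add_left, inner_sub_right, inner_sub_right, inner_sub_right,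
    hEX, real_inner_self_eq_norm_sq, real_inner_comm Y X]
  rw [← hM] at h3
  linarith

/-! ### Distance to matrices of lower rank. -/

theorem sum_overlap_mul_sub_sq_le (hY : IsSVD Y u v y) (hX : IsSVD X p q x) :
    ∑ i, ∑ j, overlap (u i) (p j) (v i) (q j) * (y i - x j) ^ 2 ≤ ‖Y - X‖ ^ 2 := by
  have h1 := sum_eq_sum_overlap_left hY hX (fun i => y i ^ 2) (fun i hi => by simp [hi])
  have h2 := sum_eq_sum_overlap_right hY hX (fun j => x j ^ 2) (fun j hj => by simp [hj])
  have h3 := sum_inner_outer_mul_le (u := u) (v := v) (p := p) (q := q) (fun i j => y i * x j)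
    (fun i j => mul_nonneg (hY.nonneg i) (hX.nonneg j))
  rw [← hX.inner_sum_smul_right, ← hY.eq_sum] at h3
  rw [norm_sub_sq_real, hY.norm_sq, hX.norm_sq, h1, h2]
  refine le_trans (le_of_eq ?_) (add_le_add_left (sub_le_sub_left
    (mul_le_mul_of_nonneg_left h3 zero_le_two) _) _)
  simp only [Finset.mul_sum, ← Finset.sum_sub_distrib, ← Finset.sum_add_distrib]
  exact Finset.sum_congr rfl fun i _ => Finset.sum_congr rfl fun j _ => by ring

/-- A weak form of the Eckart–Young bound. -/
theorem card_sub_card_mul_sq_le (hY : IsSVD Y u v y) (hX : IsSVD X p q x) {s : ℝ} (hs : 0 < s)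
    (S : Finset κ) (hS : ∀ j ∈ S, s ≤ x j) (R : Finset ι) (hR : ∀ i, i ∉ R → y i = 0) :
    ((S.card : ℝ) - R.card) * s ^ 2 ≤ ‖Y - X‖ ^ 2 := by
  classical
  refine le_trans ?_ (sum_overlap_mul_sub_sq_le hY hX)
  have hcol : ∀ j ∈ S, ∑ i, overlap (u i) (p j) (v i) (q j) = 1 := fun j hj => by
    have hj0 : x j ≠ 0 := (hs.trans_le (hS j hj)).ne'
    simp only [overlap_comm _ (p j)]
    rw [sum_overlap hY.left hY.right, hX.norm_left j hj0, hX.norm_right j hj0]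
    norm_num
  have hrow : ∀ i, ∑ j ∈ S, overlap (u i) (p j) (v i) (q j) ≤ 1 := fun i => by
    refine (Finset.sum_le_univ_sum_of_nonneg fun j => overlap_nonneg _ _ _ _).trans ?_
    rw [sum_overlap hX.left hX.right]
    have h1 := hY.left.norm_le_one i
    have h2 := hY.right.norm_le_one i
    nlinarith [norm_nonneg (u i), norm_nonneg (v i)]
  -- The columns in S carry weight |S|, and the rows in R absorb at most |R|. The rest lies on rows
  -- with yᵢ = 0, where each unit of weight costs at least s².
  have h1 : (S.card : ℝ) - R.card ≤ ∑ i ∈ Rᶜ, ∑ j ∈ S, overlap (u i) (p j) (v i) (q j) := by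
    have h2 : ∑ i, ∑ j ∈ S, overlap (u i) (p j) (v i) (q j) = S.card := by
      rw [Finset.sum_comm, Finset.sum_congr rfl hcol]; simp
    have h3 : ∑ i ∈ R, ∑ j ∈ S, overlap (u i) (p j) (v i) (q j) ≤ R.card := by
      refine (Finset.sum_le_sum fun i _ => hrow i).trans_eq (by simp)
    have h4 := Finset.sum_add_sum_compl R fun i => ∑ j ∈ S, overlap (u i) (p j) (v i) (q j)
    linarith
  calc ((S.card : ℝ) - R.card) * s ^ 2
      ≤ (∑ i ∈ Rᶜ, ∑ j ∈ S, overlap (u i) (p j) (v i) (q j)) * s ^ 2 := by gcongr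
    _ = ∑ i ∈ Rᶜ, ∑ j ∈ S, overlap (u i) (p j) (v i) (q j) * s ^ 2 := by
        simp only [Finset.sum_mul]
    _ ≤ ∑ i ∈ Rᶜ, ∑ j ∈ S, overlap (u i) (p j) (v i) (q j) * (y i - x j) ^ 2 := by
        refine Finset.sum_le_sum fun i hi => Finset.sum_le_sum fun j hj => ?_
        refine mul_le_mul_of_nonneg_left ?_ (overlap_nonneg _ _ _ _)
        rw [hR i (by simpa using hi)]
        nlinarith [hS j hj]
    _ ≤ ∑ i ∈ Rᶜ, ∑ j, overlap (u i) (p j) (v i) (q j) * (y i - x j) ^ 2 := by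
        refine Finset.sum_le_sum fun i _ => Finset.sum_le_univ_sum_of_nonneg fun j => ?_
        exact mul_nonneg (overlap_nonneg _ _ _ _) (sq_nonneg _)
    _ ≤ _ := Finset.sum_le_univ_sum_of_nonneg fun i => Finset.sum_nonneg fun j _ =>
        mul_nonneg (overlap_nonneg _ _ _ _) (sq_nonneg _)

end TwoDecompositions

/-! ### Rank: subadditivity, lower semicontinuity, counting singular values. -/

theorem natCast_rank_eq_rank_toEuclideanLin (X : Matrix (Fin n₁) (Fin n₂) 𝕜) :
    (X.rank : Cardinal) = (Matrix.toEuclideanLin X).rank := by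
  rw [rank_eq_finrank_range, Module.finrank_eq_rank]

theorem Matrix.rank_add_le_add (X Y : Matrix (Fin n₁) (Fin n₂) 𝕜) :
    (X + Y).rank ≤ X.rank + Y.rank := by
  have h := LinearMap.rank_add_le (Matrix.toEuclideanLin X) (Matrix.toEuclideanLin Y)
  rw [← map_add, ← natCast_rank_eq_rank_toEuclideanLin, ← natCast_rank_eq_rank_toEuclideanLin,
    ← natCast_rank_eq_rank_toEuclideanLin] at h
  exact_mod_cast h

theorem Matrix.rank_sub_le_add (X Y : Matrix (Fin n₁) (Fin n₂) 𝕜) :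
    (X - Y).rank ≤ X.rank + Y.rank := by
  rw [show X - Y = X + (-1 : Matrix (Fin n₁) (Fin n₁) 𝕜) * Y by
    rw [Matrix.neg_mul, Matrix.one_mul, sub_eq_add_neg]]
  exact (Matrix.rank_add_le_add _ _).trans (Nat.add_le_add_left (Matrix.rank_mul_le_right _ _) _)

theorem isClosed_setOf_rank_le (K : ℕ) :
    IsClosed {X : Matrix (Fin n₁) (Fin n₂) 𝕜 | X.rank ≤ K} := by
  have h := (isOpen_setOfPred_nat_le_rank (𝕜 := 𝕜) (E := EuclideanSpace 𝕜 (Fin n₂))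
    (F := EuclideanSpace 𝕜 (Fin n₁)) (K + 1)).isClosed_compl
  let f : Matrix (Fin n₁) (Fin n₂) 𝕜 →ₗ[𝕜]
      EuclideanSpace 𝕜 (Fin n₂) →L[𝕜] EuclideanSpace 𝕜 (Fin n₁) :=
    (LinearMap.toContinuousLinearMap.toLinearMap).comp Matrix.toEuclideanLin.toLinearMap
  have hf : Continuous f := f.continuous_of_finiteDimensional
  convert h.preimage hf using 1
  ext X
  have : ((f X : EuclideanSpace 𝕜 (Fin n₂) →L[𝕜] EuclideanSpace 𝕜 (Fin n₁)) :
      EuclideanSpace 𝕜 (Fin n₂) →ₗ[𝕜] EuclideanSpace 𝕜 (Fin n₁)) = Matrix.toEuclideanLin X := rfl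
  simp only [Set.mem_ofPred_eq, Set.mem_preimage, Set.mem_compl_iff, this,
    ← natCast_rank_eq_rank_toEuclideanLin]
  rw [Nat.cast_le, not_le, Nat.lt_succ_iff]

theorem smul_outer (r : ℝ) (p : EuclideanSpace 𝕜 (Fin n₁)) (q : EuclideanSpace 𝕜 (Fin n₂)) :
    r • outer p q = outer ((r : 𝕜) • p) q := by
  apply Matrix.toEuclideanLin.injective
  ext1 x
  rw [toEuclideanLin_smul_outer, toEuclideanLin_outer, smul_comm]

theorem outer_mul_outer {n : ℕ} (r : EuclideanSpace 𝕜 (Fin n₁)) (p p' : EuclideanSpace 𝕜 (Fin n))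
    (q : EuclideanSpace 𝕜 (Fin n₂)) : outer r p * outer p' q = ⟪p, p'⟫ • outer r q := by
  rw [outer, outer, Matrix.vecMulVec_mul_vecMulVec, outer, Matrix.vecMulVec_smul]
  congr 1
  rw [EuclideanSpace.inner_eq_star_dotProduct, dotProduct_comm]

theorem rank_sum_smul_outer_le [DecidableEq ι] (u : ι → EuclideanSpace 𝕜 (Fin n₁))
    (v : ι → EuclideanSpace 𝕜 (Fin n₂)) (x : ι → ℝ) :
    (∑ i, x i • outer (u i) (v i)).rank ≤ (Finset.univ.filter fun i => x i ≠ 0).card := by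
  have h : ∀ s : Finset ι, (∑ i ∈ s, x i • outer (u i) (v i)).rank ≤ s.card := fun s => by
    induction s using Finset.induction_on with
    | empty => simp
    | insert i s hi ih =>
      rw [Finset.sum_insert hi, Finset.card_insert_of_notMem hi, add_comm s.card]
      refine (Matrix.rank_add_le_add _ _).trans (add_le_add ?_ ih)
      rw [smul_outer]
      exact rank_outer_le _ _
  rw [← Finset.sum_filter_of_ne (p := fun i => x i ≠ 0)]
  · exact h _
  · intro i _ hi h0
    simp [h0] at hi

theorem card_singularValues_ne_zero (X : Matrix (Fin n₁) (Fin n₂) 𝕜) :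
    (Finset.univ.filter fun i : Fin (n₁ + n₂) =>
      (Matrix.toEuclideanLin X).singularValues i ≠ 0).card = X.rank := by
  simp only [Ne, singularValues_eq_zero_iff_rank_le, not_le]
  rw [Fin.card_filter_val_lt, min_eq_right]
  exact X.rank_le_height.trans (Nat.le_add_right _ _)

/-! ### Comparison of the regularized and the rank functional. -/

variable {F : Type*} [NormedAddCommGroup F] [InnerProductSpace ℝ F]

theorem regFunctional_eq (A : Matrix (Fin n₁) (Fin n₂) 𝕜 →ₗ[ℝ] F) (b : F) {μ : ℝ} (hμ : 0 < μ)
    (X : Matrix (Fin n₁) (Fin n₂) 𝕜) :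
    regFunctional A b μ X = ∑ i : Fin (n₁ + n₂), rMu μ ((Matrix.toEuclideanLin X).singularValues i)
      + ‖A X - b‖ ^ 2 := by
  rw [regFunctional]
  congr 1
  rw [Fin.sum_univ_eq_sum_range (fun i => rMu μ ((Matrix.toEuclideanLin X).singularValues i)),
    Finset.range_eq_Ico, ← Finset.sum_subset (s₁ := Finset.Ico 0 (min n₁ n₂))
      (s₂ := Finset.Ico 0 (n₁ + n₂))]
  · rw [← Finset.Ico_add_one_right_eq_Icc, ← zero_add 1, ← Finset.sum_Ico_add']
    rfl
  · exact Finset.Ico_subset_Ico_right (by omega)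
  · intro i _ hi
    have h1 := X.rank_le_height
    have h2 := X.rank_le_width
    have hi' : min n₁ n₂ ≤ i := by
      rw [Finset.mem_Ico] at hi
      omega
    rw [(singularValues_eq_zero_iff_rank_le X i).2 (by omega), rMu_zero hμ]

theorem rMu_le (μ s : ℝ) : rMu μ s ≤ μ := by
  rw [rMu]; linarith [sq_nonneg (max (√μ - s) 0)]

theorem regFunctional_le_rankFunctional (A : Matrix (Fin n₁) (Fin n₂) 𝕜 →ₗ[ℝ] F) (b : F) {μ : ℝ}
    (hμ : 0 < μ) (X : Matrix (Fin n₁) (Fin n₂) 𝕜) :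
    regFunctional A b μ X ≤ rankFunctional A b μ X := by
  rw [regFunctional_eq A b hμ, rankFunctional, ← card_singularValues_ne_zero, mul_comm,
    ← nsmul_eq_mul, ← Finset.sum_const, Finset.sum_filter]
  gcongr with i _
  split_ifs with h
  · exact rMu_le _ _
  · rw [not_not.1 h, rMu_zero hμ]

/-- The regularized functional in the coordinates of a singular value decomposition. -/
def coordFunctional (A : Matrix (Fin n₁) (Fin n₂) 𝕜 →ₗ[ℝ] F) (b : F) (μ : ℝ)
    (u : ι → EuclideanSpace 𝕜 (Fin n₁)) (v : ι → EuclideanSpace 𝕜 (Fin n₂)) (x : ι → ℝ) : ℝ :=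
  ∑ i, rMu μ (x i) + ‖A (∑ i, x i • outer (u i) (v i)) - b‖ ^ 2

/-- Strict concavity along one singular value: moving it to an end point of `[0, √μ]` decreases
the functional. -/
theorem exists_coordFunctional_update_lt [DecidableEq ι]
    (A : Matrix (Fin n₁) (Fin n₂) 𝕜 →ₗ[ℝ] F) (b : F) {μ : ℝ} (hμ : 0 < μ)
    (u : ι → EuclideanSpace 𝕜 (Fin n₁)) (v : ι → EuclideanSpace 𝕜 (Fin n₂)) (x : ι → ℝ) (i : ι)
    (hA : ‖A (outer (u i) (v i))‖ < 1) (h0 : 0 < x i) (h1 : x i < √μ) :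
    ∃ t : ℝ, (t = 0 ∨ t = √μ) ∧
      coordFunctional A b μ u v (Function.update x i t) < coordFunctional A b μ u v x := by
  set P := outer (u i) (v i) with hP
  set X := ∑ j, x j • outer (u j) (v j) with hX
  have hsum : ∀ t : ℝ, ∑ j, Function.update x i t j • outer (u j) (v j) = X + (t - x i) • P := by
    intro t
    rw [hX, ← Finset.add_sum_erase _ _ (Finset.mem_univ i),
      ← Finset.add_sum_erase _ (fun j => x j • outer (u j) (v j)) (Finset.mem_univ i),
      Function.update_self, sub_smul, Finset.sum_congr rfl (g := fun j => x j • outer (u j) (v j))]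
    · abel
    · intro j hj
      rw [Function.update_of_ne (Finset.ne_of_mem_erase hj)]
  have hsum' : ∀ t : ℝ, ∑ j, rMu μ (Function.update x i t j) =
      ∑ j, rMu μ (x j) + rMu μ t - rMu μ (x i) := by
    intro t
    rw [← Finset.add_sum_erase _ _ (Finset.mem_univ i),
      ← Finset.add_sum_erase _ (fun j => rMu μ (x j)) (Finset.mem_univ i),
      Function.update_self, Finset.sum_congr rfl (g := fun j => rMu μ (x j))]
    · ring
    · intro j hj
      rw [Function.update_of_ne (Finset.ne_of_mem_erase hj)]
  have hval : ∀ t : ℝ, coordFunctional A b μ u v (Function.update x i t) =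
      coordFunctional A b μ u v x + (rMu μ t - rMu μ (x i) +
        2 * (t - x i) * inner ℝ (A X - b) (A P) + (t - x i) ^ 2 * ‖A P‖ ^ 2) := by
    intro t
    rw [coordFunctional, coordFunctional, hsum, hsum', ← hX, map_add, map_smul,
      show A X + (t - x i) • A P - b = (A X - b) + (t - x i) • A P by abel, norm_add_sq_real,
      real_inner_smul_right, norm_smul, mul_pow, Real.norm_eq_abs, sq_abs]
    ring
  have hs := Real.sq_sqrt hμ.le
  have hα : ‖A P‖ ^ 2 < 1 := by
    rw [sq_lt_one_iff_abs_lt_one, abs_norm]; exact hA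
  by_contra! hcon
  have c0 := hcon 0 (Or.inl rfl)
  have c1 := hcon (√μ) (Or.inr rfl)
  rw [hval, rMu_zero hμ, rMu_of_le_sqrt hμ h1.le] at c0
  rw [hval, rMu_of_sqrt_le le_rfl, rMu_of_le_sqrt hμ h1.le] at c1
  set α := ‖A P‖ ^ 2
  set β : ℝ := inner ℝ (A X - b) (A P)
  have d0 : 0 ≤ x i * (x i * (1 + α) - 2 * √μ - 2 * β) := by linarith
  have d1 : 0 ≤ (√μ - x i) * ((√μ - x i) * (1 + α) + 2 * β) := by
    have : (√μ - x i) * ((√μ - x i) * (1 + α) + 2 * β) = √μ ^ 2 - (2 * √μ * x i - x i ^ 2) +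
        2 * (√μ - x i) * β + (√μ - x i) ^ 2 * α := by ring
    rw [this, hs]
    linarith
  have e0 := nonneg_of_mul_nonneg_right d0 h0
  have e1 := nonneg_of_mul_nonneg_right d1 (sub_pos.2 h1)
  -- The sum of `e0` and `e1` cancels β and xᵢ, leaving √μ (α - 1) ≥ 0, against α < 1.
  nlinarith [Real.sqrt_pos.2 hμ]

/-- The indices are treated one at a time. The alternative in the conclusion keeps track of strict
decrease, which later turns any move into a strict comparison. -/
theorem exists_coordFunctional_le [DecidableEq ι]
    (A : Matrix (Fin n₁) (Fin n₂) 𝕜 →ₗ[ℝ] F) (b : F) {μ : ℝ} (hμ : 0 < μ)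
    (u : ι → EuclideanSpace 𝕜 (Fin n₁)) (v : ι → EuclideanSpace 𝕜 (Fin n₂)) (x : ι → ℝ)
    (hx : ∀ i, 0 ≤ x i) (hA : ∀ i, ‖A (outer (u i) (v i))‖ < 1) (S : Finset ι) :
    ∃ x' : ι → ℝ, (∀ i, 0 ≤ x' i) ∧ (∀ i ∈ S, x' i = 0 ∨ √μ ≤ x' i) ∧
      (x' = x ∨ coordFunctional A b μ u v x' < coordFunctional A b μ u v x) := by
  induction S using Finset.induction_on with
  | empty => exact ⟨x, hx, by simp, Or.inl rfl⟩
  | insert i S _ ih =>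
    obtain ⟨x', h0, hS, hval⟩ := ih
    by_cases hi : x' i = 0 ∨ √μ ≤ x' i
    · refine ⟨x', h0, fun j hj => ?_, hval⟩
      rcases Finset.mem_insert.1 hj with rfl | hj
      · exact hi
      · exact hS j hj
    · push Not at hi
      obtain ⟨t, ht, hlt⟩ := exists_coordFunctional_update_lt A b hμ u v x' i (hA i)
        ((h0 i).lt_of_ne' hi.1) hi.2
      refine ⟨Function.update x' i t, fun j => ?_, fun j hj => ?_, Or.inr ?_⟩
      · rcases eq_or_ne j i with rfl | hji
        · rw [Function.update_self]
          rcases ht with rfl | rfl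
          · exact le_rfl
          · exact Real.sqrt_nonneg μ
        · rw [Function.update_of_ne hji]; exact h0 j
      · rcases eq_or_ne j i with rfl | hji
        · rw [Function.update_self]
          exact ht.imp id fun h => h.ge
        · rw [Function.update_of_ne hji]
          exact hS j ((Finset.mem_insert.1 hj).resolve_left hji)
      · rcases hval with rfl | hval
        · exact hlt
        · exact hlt.trans hval

/-- If `A` is a strict contraction, then the regularized functional attains no smaller values than
the rank functional. -/
theorem rankFunctional_le_or_exists_lt (A : Matrix (Fin n₁) (Fin n₂) 𝕜 →ₗ[ℝ] F) (b : F) {μ : ℝ}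
    (hμ : 0 < μ) (hA : ∀ X, ‖X‖ ≤ 1 → ‖A X‖ < 1) (X : Matrix (Fin n₁) (Fin n₂) 𝕜) :
    rankFunctional A b μ X ≤ regFunctional A b μ X ∨
      ∃ X', rankFunctional A b μ X' < regFunctional A b μ X := by
  obtain ⟨u, v, h⟩ := exists_isSVD X
  have hreg : regFunctional A b μ X = coordFunctional A b μ u v
      (fun i => (Matrix.toEuclideanLin X).singularValues i) := by
    rw [regFunctional_eq A b hμ, coordFunctional, ← h.eq_sum]
  obtain ⟨x', -, hS, hval⟩ := exists_coordFunctional_le A b hμ u v _ h.nonneg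
    (fun i => hA _ (by
      rw [norm_outer]
      exact mul_le_one₀ (h.left.norm_le_one i) (norm_nonneg _) (h.right.norm_le_one i)))
    Finset.univ
  have hle : rankFunctional A b μ (∑ i, x' i • outer (u i) (v i)) ≤
      coordFunctional A b μ u v x' := by
    rw [rankFunctional, coordFunctional]
    gcongr
    have h1 : ∑ i, rMu μ (x' i) = μ * (Finset.univ.filter fun i => x' i ≠ 0).card := by
      rw [mul_comm, ← nsmul_eq_mul, ← Finset.sum_const, Finset.sum_filter]
      refine Finset.sum_congr rfl fun i _ => ?_
      split_ifs with hi
      · exact rMu_of_sqrt_le ((hS i (Finset.mem_univ i)).resolve_left hi)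
      · rw [not_not.1 hi, rMu_zero hμ]
    rw [h1]
    gcongr
    exact rank_sum_smul_outer_le u v x'
  rw [hreg]
  rcases hval with rfl | hval
  · left
    rwa [← h.eq_sum] at hle
  · exact Or.inr ⟨_, hle.trans_lt hval⟩

/-! ### Stability of the smallest nonzero singular value. -/

/-- A matrix of rank less than `K` is far from a matrix with large `K`-th singular value. -/
theorem rank_sub_rank_mul_singVal_sq_le (X Y : Matrix (Fin n₁) (Fin n₂) 𝕜) {K : ℕ} (hK : 1 ≤ K)
    (hX : X.rank = K) :
    ((K : ℝ) - Y.rank) * singVal X K ^ 2 ≤ ‖Y - X‖ ^ 2 := by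
  obtain ⟨p, q, hp⟩ := exists_isSVD X
  obtain ⟨u, v, hu⟩ := exists_isSVD Y
  have hpos : 0 < singVal X K := by
    refine (LinearMap.singularValues_nonneg _ _).lt_of_ne' fun h => ?_
    rw [singularValues_eq_zero_iff_rank_le] at h
    omega
  have h := card_sub_card_mul_sq_le hu hp hpos
    (Finset.univ.filter fun i : Fin (n₁ + n₂) =>
      (Matrix.toEuclideanLin X).singularValues i ≠ 0)
    (fun j hj => by
      rw [Finset.mem_filter, Ne, singularValues_eq_zero_iff_rank_le] at hj
      exact (Matrix.toEuclideanLin X).singularValues_antitone (by omega))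
    (Finset.univ.filter fun i : Fin (n₁ + n₂) =>
      (Matrix.toEuclideanLin Y).singularValues i ≠ 0)
    (fun i hi => by simpa using hi)
  rwa [card_singularValues_ne_zero, card_singularValues_ne_zero, hX] at h

/-- Deleting the i-th singular component of Y costs σᵢ(Y) and drops the rank below K, so the result
has distance at least σ_K(X) from X. -/
theorem singVal_le_norm_sub_add_singularValue (X Y : Matrix (Fin n₁) (Fin n₂) 𝕜) {K : ℕ}
    (hK : 1 ≤ K) (hX : X.rank = K) (hY : Y.rank ≤ K) (i : ℕ)
    (hi : (Matrix.toEuclideanLin Y).singularValues i ≠ 0) :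
    singVal X K ≤ ‖Y - X‖ + (Matrix.toEuclideanLin Y).singularValues i := by
  obtain ⟨u, v, hu⟩ := exists_isSVD Y
  have hin : i < n₁ + n₂ := by
    rw [Ne, singularValues_eq_zero_iff_rank_le] at hi
    have := Y.rank_le_height
    omega
  set k : Fin (n₁ + n₂) := ⟨i, hin⟩
  set y : Fin (n₁ + n₂) → ℝ := fun j => (Matrix.toEuclideanLin Y).singularValues j with hy
  have hyk : y k ≠ 0 := hi
  set P := outer (u k) (v k)
  have hsum : ∑ j, Function.update y k 0 j • outer (u j) (v j) = Y - y k • P := by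
    conv_rhs => rw [hu.eq_sum]
    rw [← Finset.add_sum_erase _ _ (Finset.mem_univ k),
      ← Finset.add_sum_erase _ (fun j => y j • outer (u j) (v j)) (Finset.mem_univ k),
      Function.update_self, Finset.sum_congr rfl (g := fun j => y j • outer (u j) (v j))]
    · simp [P]
    · intro j hj
      rw [Function.update_of_ne (Finset.ne_of_mem_erase hj)]
  have hrank : (Y - y k • P).rank < K := by
    rw [← hsum]
    refine (rank_sum_smul_outer_le _ _ _).trans_lt (lt_of_lt_of_le ?_ hY)
    rw [← card_singularValues_ne_zero Y]
    refine Finset.card_lt_card ⟨fun j hj => ?_, fun hsub => ?_⟩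
    · rcases eq_or_ne j k with rfl | hjk
      · simp at hj
      · simpa [Function.update_of_ne hjk] using hj
    · have := hsub (Finset.mem_filter.2 ⟨Finset.mem_univ k, hyk⟩)
      simp at this
  have h1 := rank_sub_rank_mul_singVal_sq_le X (Y - y k • P) hK hX
  have h2 : (1 : ℝ) ≤ (K : ℝ) - (Y - y k • P).rank := by
    have : ((Y - y k • P).rank : ℝ) + 1 ≤ K := by exact_mod_cast hrank
    linarith
  have h3 : singVal X K ^ 2 ≤ ‖Y - y k • P - X‖ ^ 2 := by
    nlinarith [sq_nonneg (singVal X K)]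
  have h4 := le_of_sq_le_sq h3 (norm_nonneg _)
  refine h4.trans ?_
  rw [sub_right_comm]
  refine (norm_sub_le _ _).trans ?_
  rw [norm_smul, norm_outer, hu.norm_left k hyk, hu.norm_right k hyk, Real.norm_eq_abs,
    abs_of_nonneg (hu.nonneg k)]
  simp [hy, k]

/-! ### Normal equations of best rank-K solutions. -/

theorem inner_map_eq_zero_of_best
    {A : Matrix (Fin n₁) (Fin n₂) 𝕜 →ₗ[ℝ] F} {b : F} {K : ℕ} {X : Matrix (Fin n₁) (Fin n₂) 𝕜}
    (hX : X ∈ bestRankSolutions A b K) (M : Matrix (Fin n₁) (Fin n₂) 𝕜)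
    (hM : ∀ t : ℝ, (X + t • M).rank ≤ K) : inner ℝ (A M) (b - A X) = 0 := by
  have h : ∀ t : ℝ, 0 ≤ -2 * t * inner ℝ (A M) (b - A X) + t ^ 2 * ‖A M‖ ^ 2 := by
    intro t
    have h1 := pow_le_pow_left₀ (norm_nonneg _) (hX.2 _ (hM t)) 2
    rw [map_add, map_smul, show A X + t • A M - b = t • A M - (b - A X) by abel, norm_sub_rev,
      norm_sub_sq_real (t • A M), real_inner_smul_left, norm_smul, mul_pow, Real.norm_eq_abs,
      sq_abs] at h1
    linarith
  set β : ℝ := inner ℝ (A M) (b - A X)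
  set γ : ℝ := ‖A M‖ ^ 2
  have hγ : 0 ≤ γ := by positivity
  -- Near the vertex β / γ of the parabola; the added 1 also covers γ = 0.
  have h2 := h (β / (γ + 1))
  have h3 : -2 * (β / (γ + 1)) * β + (β / (γ + 1)) ^ 2 * γ = -(β ^ 2 * (γ + 2) / (γ + 1) ^ 2) := by
    field_simp
    ring
  rw [h3, Left.nonneg_neg_iff] at h2
  by_contra hβ
  have : 0 < β ^ 2 * (γ + 2) / (γ + 1) ^ 2 := by positivity
  linarith

theorem IsSVD.mul_outer {X : Matrix (Fin n₁) (Fin n₂) 𝕜}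
    {p : κ → EuclideanSpace 𝕜 (Fin n₁)} {q : κ → EuclideanSpace 𝕜 (Fin n₂)} {x : κ → ℝ}
    (hX : IsSVD X p q x) {j : κ} (hj : x j ≠ 0) (s : EuclideanSpace 𝕜 (Fin n₂)) :
    X * outer (q j) s = x j • outer (p j) s := by
  conv_lhs => rw [hX.eq_sum]
  rw [Matrix.sum_mul, Finset.sum_eq_single j]
  · rw [Matrix.smul_mul, outer_mul_outer, inner_self_eq_norm_sq_to_K, hX.norm_right j hj]
    simp
  · intro i _ hi
    rw [Matrix.smul_mul, outer_mul_outer, hX.right.orthogonal i j hi, zero_smul, smul_zero]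
  · simp

theorem IsSVD.outer_mul {X : Matrix (Fin n₁) (Fin n₂) 𝕜}
    {p : κ → EuclideanSpace 𝕜 (Fin n₁)} {q : κ → EuclideanSpace 𝕜 (Fin n₂)} {x : κ → ℝ}
    (hX : IsSVD X p q x) {j : κ} (hj : x j ≠ 0) (r : EuclideanSpace 𝕜 (Fin n₁)) :
    outer r (p j) * X = x j • outer r (q j) := by
  conv_lhs => rw [hX.eq_sum]
  rw [Matrix.mul_sum, Finset.sum_eq_single j]
  · rw [Matrix.mul_smul, outer_mul_outer, inner_self_eq_norm_sq_to_K, hX.norm_left j hj]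
    simp
  · intro i _ hi
    rw [Matrix.mul_smul, outer_mul_outer, hX.left.orthogonal j i hi.symm, zero_smul, smul_zero]
  · simp

/-- Choosing z to be the scalar product itself turns its real part into a squared modulus. -/
theorem inner_toEuclideanLin_eq_zero {E : Matrix (Fin n₁) (Fin n₂) 𝕜}
    {r : EuclideanSpace 𝕜 (Fin n₁)} {s : EuclideanSpace 𝕜 (Fin n₂)}
    (h : ∀ z : 𝕜, inner ℝ (outer (z • r) s) E = 0) :
    ⟪r, Matrix.toEuclideanLin E s⟫ = 0 := by
  have h1 := h ⟪r, Matrix.toEuclideanLin E s⟫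
  rw [inner_outer_left, inner_smul_left, RCLike.conj_mul, ← RCLike.ofReal_pow, RCLike.ofReal_re,
    sq_eq_zero_iff, norm_eq_zero] at h1
  exact h1

/-- The normal equations of a best rank-`K` solution, for its left singular vectors. -/
theorem inner_left_singular_vector_eq_zero [FiniteDimensional ℝ F]
    {A : Matrix (Fin n₁) (Fin n₂) 𝕜 →ₗ[ℝ] F} {b : F} {K : ℕ} {X : Matrix (Fin n₁) (Fin n₂) 𝕜}
    (hbest : X ∈ bestRankSolutions A b K) {p : κ → EuclideanSpace 𝕜 (Fin n₁)}
    {q : κ → EuclideanSpace 𝕜 (Fin n₂)} {x : κ → ℝ} (hX : IsSVD X p q x) {j : κ} (hj : x j ≠ 0)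
    (s : EuclideanSpace 𝕜 (Fin n₂)) :
    ⟪p j, Matrix.toEuclideanLin (LinearMap.adjoint A (b - A X)) s⟫ = 0 := by
  refine inner_toEuclideanLin_eq_zero fun z => ?_
  rw [LinearMap.adjoint_inner_right]
  refine inner_map_eq_zero_of_best hbest _ fun t => ?_
  -- The direction factors through X, so the whole line X + tM consists of multiples of X and keeps
  -- rank at most K.
  have h1 : outer (z • p j) s = X * ((x j)⁻¹ • z • outer (q j) s) := by
    rw [Matrix.mul_smul, Matrix.mul_smul, hX.mul_outer hj, smul_comm z, smul_smul,
      inv_mul_cancel₀ hj, one_smul]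
    simp [outer, Matrix.smul_vecMulVec]
  rw [h1, ← Matrix.mul_smul]
  nth_rw 1 [← Matrix.mul_one X]
  rw [← Matrix.mul_add]
  exact (Matrix.rank_mul_le_left _ _).trans hbest.1

/-- The normal equations of a best rank-`K` solution, for its right singular vectors. -/
theorem apply_right_singular_vector_eq_zero [FiniteDimensional ℝ F]
    {A : Matrix (Fin n₁) (Fin n₂) 𝕜 →ₗ[ℝ] F} {b : F} {K : ℕ} {X : Matrix (Fin n₁) (Fin n₂) 𝕜}
    (hbest : X ∈ bestRankSolutions A b K) {p : κ → EuclideanSpace 𝕜 (Fin n₁)}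
    {q : κ → EuclideanSpace 𝕜 (Fin n₂)} {x : κ → ℝ} (hX : IsSVD X p q x) {j : κ}
    (hj : x j ≠ 0) :
    Matrix.toEuclideanLin (LinearMap.adjoint A (b - A X)) (q j) = 0 := by
  refine ext_inner_left 𝕜 fun r => ?_
  rw [inner_zero_right]
  refine inner_toEuclideanLin_eq_zero fun z => ?_
  rw [LinearMap.adjoint_inner_right]
  refine inner_map_eq_zero_of_best hbest _ fun t => ?_
  have h1 : outer (z • r) (q j) = ((x j)⁻¹ • outer (z • r) (p j)) * X := by
    rw [Matrix.smul_mul, hX.outer_mul hj, smul_smul, inv_mul_cancel₀ hj, one_smul]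
  rw [h1, ← Matrix.smul_mul]
  nth_rw 1 [← Matrix.one_mul X]
  rw [← Matrix.add_mul]
  exact (Matrix.rank_mul_le_right _ _).trans hbest.1

/-! ### Stationary points of rank at most K. -/

theorem IsStationaryPt.eventually_le {E : Type*} [NormedAddCommGroup E] {g : E → ℝ} {X : E}
    (h : IsStationaryPt g X) {η : ℝ} (hη : 0 < η) :
    ∀ᶠ Y in 𝓝[≠] X, -η * ‖Y - X‖ ≤ g Y - g X := by
  have h1 : ((-η : ℝ) : EReal) < liminf (fun Y => (((g Y - g X) / ‖Y - X‖ : ℝ) : EReal)) (𝓝[≠] X) :=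
    lt_of_lt_of_le (by exact_mod_cast neg_lt_zero.2 hη) h
  filter_upwards [eventually_lt_of_lt_liminf h1, self_mem_nhdsWithin] with Y hY hne
  have hpos : 0 < ‖Y - X‖ := norm_pos_iff.2 (sub_ne_zero.2 hne)
  exact ((lt_div_iff₀ hpos).1 (EReal.coe_lt_coe_iff.1 hY)).le

theorem isStationaryPt_of_mem_globalMinimizers {E : Type*} [NormedAddCommGroup E] {g : E → ℝ}
    {X : E} (h : X ∈ globalMinimizers g) : IsStationaryPt g X := by
  refine le_liminf_of_le (by isBoundedDefault) (Eventually.of_forall fun Y => ?_)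
  exact_mod_cast div_nonneg (sub_nonneg.2 (h Y)) (norm_nonneg _)

/-- A stationary point of rank at most `K` coincides with a best rank-`K` solution whose
singular values and residual leave a gap. -/
theorem IsStationaryPt.eq_of_best [FiniteDimensional ℝ F]
    {A : Matrix (Fin n₁) (Fin n₂) 𝕜 →ₗ[ℝ] F} {b : F} {K : ℕ} {μ c c' : ℝ} (hμ : 0 < μ)
    (hA : ∀ X, ‖A X‖ ≤ ‖X‖) (hc' : 0 < c') (hcc : c' < c) (hc : c ≤ 1)
    (hrip : ∀ X : Matrix (Fin n₁) (Fin n₂) 𝕜, X.rank ≤ 2 * K → c * ‖X‖ ^ 2 ≤ ‖A X‖ ^ 2)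
    {B X : Matrix (Fin n₁) (Fin n₂) 𝕜} (hB : B ∈ bestRankSolutions A b K)
    (hres : ‖b - A B‖ ≤ c' * √μ)
    (hgap : ∀ i : ℕ, (Matrix.toEuclideanLin B).singularValues i = 0 ∨
      √μ ≤ c' * (Matrix.toEuclideanLin B).singularValues i)
    (hX : IsStationaryPt (regFunctional A b μ) X) (hXK : X.rank ≤ K) : X = B := by
  by_contra hne
  obtain ⟨p, q, hp⟩ := exists_isSVD B
  set E := LinearMap.adjoint A (b - A B) with hE
  have hop : ∀ r s, RCLike.re ⟪r, Matrix.toEuclideanLin E s⟫ ≤ ‖b - A B‖ * (‖r‖ * ‖s‖) := by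
    intro r s
    rw [← inner_outer_left, hE, LinearMap.adjoint_inner_right, ← norm_outer, mul_comm]
    exact (real_inner_le_norm _ _).trans (mul_le_mul_of_nonneg_right (hA _) (norm_nonneg _))
  have hD : 0 < ‖X - B‖ := norm_pos_iff.2 (sub_ne_zero.2 hne)
  have hripD : c * ‖X - B‖ ^ 2 ≤ ‖A (X - B)‖ ^ 2 := by
    refine hrip _ ((Matrix.rank_sub_le_add _ _).trans ?_)
    have := hB.1
    omega
  -- Towards B the functional falls at rate at least 2(c - c')‖X - B‖ up to O(t). Half of that rate
  -- contradicts stationarity, and t < (c - c')/2 controls the O(t) term.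
  have hev := hX.eventually_le (η := (c - c') * ‖X - B‖) (mul_pos (sub_pos.2 hcc) hD)
  have hline : Tendsto (fun t : ℝ => X - t • (X - B)) (𝓝[>] 0) (𝓝[≠] X) := by
    refine tendsto_nhdsWithin_iff.2 ⟨?_, ?_⟩
    · have : Continuous fun t : ℝ => X - t • (X - B) := by fun_prop
      have h := this.tendsto 0
      simp only [zero_smul, sub_zero] at h
      exact h.mono_left nhdsWithin_le_nhds
    · filter_upwards [self_mem_nhdsWithin] with t ht
      simp only [Set.mem_compl_iff, Set.mem_singleton_iff, sub_eq_self, smul_eq_zero, not_or]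
      exact ⟨(Set.mem_Ioi.1 ht).ne', sub_ne_zero.2 hne⟩
  have hsmall : ∀ᶠ t : ℝ in 𝓝[>] 0, t < (c - c') / 2 :=
    (eventually_lt_nhds (by linarith)).filter_mono nhdsWithin_le_nhds
  obtain ⟨t, ⟨ht1, ht2⟩, ht0⟩ :=
    (((hline.eventually hev).and hsmall).and self_mem_nhdsWithin).exists
  have ht0 : 0 < t := ht0
  set D := X - B with hDdef
  set Y := X - t • D with hY
  obtain ⟨u, v, hu⟩ := exists_isSVD Y
  obtain ⟨u', v', hu'⟩ := exists_isSVD X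
  set W := ∑ i : Fin (n₁ + n₂), max (√μ) ((Matrix.toEuclideanLin Y).singularValues i) •
    outer (u i) (v i) with hW
  -- The subgradient is taken at the moved point Y, not at X: convexity then bounds the value at Y
  -- from above by the value at X.
  have hsub := spectral_subgradient hμ hu hu'
  have hmono := strong_monotone_of_gap hμ hc' (hcc.trans_le hc) (norm_nonneg _) hres hu hp
    (fun j => hgap j) hop (fun j hj s => inner_left_singular_vector_eq_zero hB hp hj s)
    (fun j hj => apply_right_singular_vector_eq_zero hB hp hj)
  have hYX : Y - X = -(t • D) := by rw [hY]; abel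
  have hXY : X - Y = t • D := by rw [hY]; abel
  have hYB : Y - B = (1 - t) • D := by rw [hY, sub_smul, one_smul, hDdef]; abel
  have ht1' : 0 < 1 - t := by linarith
  rw [hYB, norm_smul, real_inner_smul_right, mul_pow, Real.norm_eq_abs, sq_abs] at hmono
  have hmono' : (1 - c') * (1 - t) * ‖D‖ ^ 2 ≤ inner ℝ (W - (B + E)) D := by
    refine le_of_mul_le_mul_left ?_ ht1'
    linarith
  rw [hXY, real_inner_smul_right] at hsub
  rw [hYX, norm_neg, norm_smul, Real.norm_eq_abs, abs_of_pos ht0, regFunctional_eq A b hμ,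
    regFunctional_eq A b hμ] at ht1
  have hAY : ‖A Y - b‖ ^ 2 = ‖A X - b‖ ^ 2 - 2 * t * inner ℝ (A X - b) (A D) +
      t ^ 2 * ‖A D‖ ^ 2 := by
    rw [hY, map_sub, map_smul, sub_right_comm, norm_sub_sq_real, real_inner_smul_right, norm_smul,
      mul_pow, Real.norm_eq_abs, sq_abs]
    ring
  have hYn : ‖Y‖ ^ 2 = ‖X‖ ^ 2 - 2 * t * inner ℝ X D + t ^ 2 * ‖D‖ ^ 2 := by
    rw [hY, norm_sub_sq_real, real_inner_smul_right, norm_smul, mul_pow, Real.norm_eq_abs, sq_abs]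
    ring
  have hED : inner ℝ E D = inner ℝ (b - A B) (A D) := by
    rw [hE, LinearMap.adjoint_inner_left]
  have hXD : inner ℝ X D = inner ℝ B D + ‖D‖ ^ 2 := by
    rw [← real_inner_self_eq_norm_sq, ← inner_add_left, hDdef]; congr 1; abel
  have hAXD : inner ℝ (A X - b) (A D) = ‖A D‖ ^ 2 - inner ℝ (b - A B) (A D) := by
    rw [← real_inner_self_eq_norm_sq, ← inner_sub_left, hDdef, map_sub]; congr 1; abel
  rw [inner_sub_left, inner_add_left, hED] at hmono'
  have hADle : ‖A D‖ ^ 2 ≤ ‖D‖ ^ 2 := pow_le_pow_left₀ (norm_nonneg _) (hA D) 2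
  rw [hAY, hAXD] at ht1
  rw [hYn, hXD] at hsub
  have hfin : t * (-((c - c') * ‖D‖ ^ 2)) ≤ t * (2 * ‖D‖ ^ 2 - 2 * ‖A D‖ ^ 2 -
      2 * ((1 - c') * (1 - t) * ‖D‖ ^ 2) + t * (‖A D‖ ^ 2 - ‖D‖ ^ 2)) := by
    have := mul_le_mul_of_nonneg_left hmono' ht0.le
    linarith
  have hfin' := le_of_mul_le_mul_left hfin ht0
  have hD2 : 0 < ‖D‖ ^ 2 := by positivity
  have k1 : t * (‖A D‖ ^ 2 - ‖D‖ ^ 2) ≤ 0 := mul_nonpos_of_nonneg_of_nonpos ht0.le (by linarith)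
  have k2 : t * (1 - c') * ‖D‖ ^ 2 < (c - c') / 2 * ‖D‖ ^ 2 := by
    refine mul_lt_mul_of_pos_right (lt_of_le_of_lt ?_ ht2) hD2
    exact mul_le_of_le_one_right ht0.le (by linarith)
  linarith

/-! ### Existence of best solutions, and exclusion of other ranks. -/

theorem exists_mem_bestRankSolutions
    (A : Matrix (Fin n₁) (Fin n₂) 𝕜 →ₗ[ℝ] F) (b : F) {K : ℕ} {c : ℝ} (hc : 0 < c)
    (hrip : ∀ X : Matrix (Fin n₁) (Fin n₂) 𝕜, X.rank ≤ 2 * K → c * ‖X‖ ^ 2 ≤ ‖A X‖ ^ 2) :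
    ∃ X, X ∈ bestRankSolutions A b K := by
  have hcont : Continuous fun X => ‖A X - b‖ :=
    ((A.continuous_of_finiteDimensional).sub continuous_const).norm
  set S : Set (Matrix (Fin n₁) (Fin n₂) 𝕜) := {X | X.rank ≤ K} ∩ {X | ‖A X - b‖ ≤ ‖b‖} with hS
  have hclosed : IsClosed S :=
    (isClosed_setOf_rank_le K).inter (isClosed_le hcont continuous_const)
  have hbdd : Bornology.IsBounded S := by
    refine (Metric.isBounded_closedBall (x := (0 : Matrix (Fin n₁) (Fin n₂) 𝕜))
      (r := 2 * ‖b‖ / √c)).subset fun X hX => ?_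
    rw [mem_closedBall_zero_iff, le_div_iff₀ (Real.sqrt_pos.2 hc)]
    have h1 : ‖A X‖ ≤ 2 * ‖b‖ := by
      have := norm_add_le (A X - b) b
      rw [sub_add_cancel] at this
      linarith [hX.2.out]
    refine le_trans ?_ h1
    refine le_of_sq_le_sq ?_ (norm_nonneg _)
    rw [mul_pow, Real.sq_sqrt hc.le, mul_comm]
    exact hrip X (hX.1.out.trans (by omega))
  have : ProperSpace (Matrix (Fin n₁) (Fin n₂) 𝕜) := FiniteDimensional.proper ℝ _
  obtain ⟨X, hX, hmin⟩ := (Metric.isCompact_of_isClosed_isBounded hclosed hbdd).exists_isMinOn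
    ⟨0, by simp [hS]⟩ hcont.continuousOn
  refine ⟨X, hX.1, fun Y hY => ?_⟩
  by_cases h : ‖A Y - b‖ ≤ ‖b‖
  · exact hmin ⟨hY, h⟩
  · exact hX.2.out.trans (not_le.1 h).le

/-- Any admissible constant below 1 suffices, so attainment of the infimum is never needed. -/
theorem exists_contraction_const {A : Matrix (Fin n₁) (Fin n₂) 𝕜 →ₗ[ℝ] F} (hA : opNorm A < 1) :
    ∃ C : ℝ, 0 ≤ C ∧ C < 1 ∧ ∀ X, ‖A X‖ ≤ C * ‖X‖ := by
  obtain ⟨C₀, hC₀, hbound⟩ := SemilinearMapClass.bound_of_continuous A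
    A.continuous_of_finiteDimensional
  have hne : {c : ℝ | 0 ≤ c ∧ ∀ X : Matrix (Fin n₁) (Fin n₂) 𝕜, ‖A X‖ ≤ c * ‖X‖}.Nonempty :=
    ⟨C₀, hC₀.le, hbound⟩
  obtain ⟨C, hC, hlt⟩ := exists_lt_of_csInf_lt hne hA
  exact ⟨C, hC.1, hlt, hC.2⟩

theorem lripConst_mul_norm_sq_le (A : Matrix (Fin n₁) (Fin n₂) 𝕜 →ₗ[ℝ] F) {K : ℕ}
    {X : Matrix (Fin n₁) (Fin n₂) 𝕜} (hX : X.rank ≤ K) :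
    (1 - lripConst A K) * ‖X‖ ^ 2 ≤ ‖A X‖ ^ 2 := by
  rcases eq_or_ne X 0 with rfl | h0
  · simp
  · have hpos : 0 < ‖X‖ ^ 2 := pow_pos (norm_pos_iff.2 h0) 2
    rw [← le_div_iff₀ hpos, lripConst, sub_sub_cancel]
    exact csInf_le ⟨0, by rintro _ ⟨Y, -, -, rfl⟩; positivity⟩ ⟨X, h0, hX, rfl⟩

/-- Under the noise and signal bounds, matrices of rank other than `K` have a larger value of the
rank functional than any best rank-`K` solution can have. -/
theorem lt_rankFunctional_of_rank_ne {A : Matrix (Fin n₁) (Fin n₂) 𝕜 →ₗ[ℝ] F}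
    {X₀ Y : Matrix (Fin n₁) (Fin n₂) 𝕜} {ε b : F} (hb : b = A X₀ + ε) {K : ℕ} (hK : 1 ≤ K)
    (hX₀ : X₀.rank = K) {μ c : ℝ} (hμ : 0 < μ) (hc : 0 < c) (hc1 : c < 1)
    (hrip : ∀ X : Matrix (Fin n₁) (Fin n₂) 𝕜, X.rank ≤ 2 * K → c * ‖X‖ ^ 2 ≤ ‖A X‖ ^ 2)
    (hε : ‖ε‖ ≤ c * √c * √μ / 3) (hσ : (1 / c + c) * √μ < singVal X₀ K) (hY : Y.rank ≠ K) :
    μ * K + ‖ε‖ ^ 2 < rankFunctional A b μ Y := by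
  set s := √c with hs
  set a := √μ with ha
  have hs0 : 0 < s := Real.sqrt_pos.2 hc
  have ha0 : 0 < a := Real.sqrt_pos.2 hμ
  have hcs : c = s ^ 2 := (Real.sq_sqrt hc.le).symm
  have hμa : μ = a ^ 2 := (Real.sq_sqrt hμ.le).symm
  have hs1 : s < 1 := by nlinarith
  have hε0 : 0 ≤ ‖ε‖ := norm_nonneg ε
  have hε2 : ‖ε‖ ≤ s ^ 3 * a / 3 := by rw [hcs] at hε; linarith [hε]
  have hεlt : ‖ε‖ ^ 2 < μ := by
    have h3 : s ^ 3 ≤ 1 := pow_le_one₀ hs0.le hs1.le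
    rw [hμa]
    exact pow_lt_pow_left₀ (by nlinarith) hε0 two_ne_zero
  rw [rankFunctional]
  rcases lt_or_gt_of_ne hY with hlt | hgt
  · have hm : (1 : ℝ) ≤ (K : ℝ) - Y.rank := by
      have : (Y.rank : ℝ) + 1 ≤ K := by exact_mod_cast hlt
      linarith
    set m := (K : ℝ) - Y.rank with hmdef
    have h1 := rank_sub_rank_mul_singVal_sq_le X₀ Y hK hX₀
    have h2 := hrip (Y - X₀) ((Matrix.rank_sub_le_add _ _).trans (by omega))
    have h3 : ‖A (Y - X₀)‖ ≤ ‖A Y - b‖ + ‖ε‖ := by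
      rw [map_sub, show A Y - A X₀ = (A Y - b) + ε by rw [hb]; abel]
      exact norm_add_le _ _
    have hr1 : 1 ≤ √m := Real.one_le_sqrt.2 hm
    have hr2 : √m ^ 2 = m := Real.sq_sqrt (by linarith)
    have hσ' : (1 / s + s ^ 3) * a < s * singVal X₀ K := by
      have := mul_lt_mul_of_pos_left hσ hs0
      rw [hcs] at this
      refine lt_of_eq_of_lt ?_ this
      field_simp
    have hL : √m * (s * singVal X₀ K) ≤ ‖A (Y - X₀)‖ := by
      refine le_of_sq_le_sq ?_ (norm_nonneg _)
      rw [mul_pow, mul_pow, hr2, ← hcs]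
      nlinarith
    -- Removing the noise costs s³a/3, at most a third of the s³ term since √m ≥ 1. In the square,
    -- m/s² pays for the m missing ranks and (4/9)s⁶ covers ‖ε‖².
    have hL2 : √m * ((1 / s + 2 / 3 * s ^ 3) * a) ≤ ‖A Y - b‖ := by
      have k1 : √m * ((1 / s + s ^ 3) * a) ≤ √m * (s * singVal X₀ K) := by gcongr
      have k2 : s ^ 3 * a / 3 ≤ √m * (s ^ 3 * a / 3) := le_mul_of_one_le_left (by positivity) hr1
      linarith
    have hL3 := pow_le_pow_left₀ (by positivity) hL2 2
    rw [mul_pow, hr2] at hL3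
    have hexp : ((1 / s + 2 / 3 * s ^ 3) * a) ^ 2 =
        (1 / s ^ 2 + 4 / 3 * s ^ 2 + 4 / 9 * s ^ 6) * a ^ 2 := by
      field_simp
      ring
    have hinv : 1 < 1 / s ^ 2 := by
      rw [one_lt_div (by positivity)]
      exact pow_lt_one₀ hs0.le hs1 two_ne_zero
    have hεsq : ‖ε‖ ^ 2 ≤ 4 / 9 * s ^ 6 * a ^ 2 := by
      have := pow_le_pow_left₀ hε0 hε2 2
      have h6 : 0 ≤ s ^ 6 * a ^ 2 := by positivity
      nlinarith
    have hfin : m * μ + ‖ε‖ ^ 2 < m * ((1 / s + 2 / 3 * s ^ 3) * a) ^ 2 := by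
      rw [hexp, hμa]
      have k1 : a ^ 2 < 1 / s ^ 2 * a ^ 2 := lt_mul_of_one_lt_left (by positivity) hinv
      have k2 : a ^ 2 + ‖ε‖ ^ 2 < (1 / s ^ 2 + 4 / 3 * s ^ 2 + 4 / 9 * s ^ 6) * a ^ 2 := by
        have : 0 ≤ 4 / 3 * s ^ 2 * a ^ 2 := by positivity
        linarith
      have k3 := mul_lt_mul_of_pos_left k2 (by linarith : 0 < m)
      have k4 : ‖ε‖ ^ 2 ≤ m * ‖ε‖ ^ 2 := le_mul_of_one_le_left (by positivity) hm
      linarith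
    have : μ * K = m * μ + μ * Y.rank := by rw [hmdef]; ring
    linarith
  · have h1 : (K : ℝ) + 1 ≤ Y.rank := by exact_mod_cast hgt
    nlinarith [sq_nonneg ‖A Y - b‖]

end SVD
end

/-- `A` is an arbitrary real-linear operator from the real or complex `n₁ × n₂` matrices (with the
Frobenius norm) to a finite-dimensional real inner product space `F`, e.g. `ℝᵐ`, or `ℂᵐ` viewed as
a real space; `opNorm A` is its operator norm. -/
theorem theorem1p1 {𝕜 : Type*} [RCLike 𝕜] {n₁ n₂ : ℕ}
    {F : Type*} [NormedAddCommGroup F] [InnerProductSpace ℝ F] [FiniteDimensional ℝ F]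
    (A : Matrix (Fin n₁) (Fin n₂) 𝕜 →ₗ[ℝ] F) (hA : opNorm A < 1)
    (X₀ : Matrix (Fin n₁) (Fin n₂) 𝕜) (ε b : F) (hb : b = A X₀ + ε)
    (K : ℕ) (hK : 1 ≤ K) (hX₀ : X₀.rank = K)
    (hδ : lripConst A (2 * K) < 1)
    (μ : ℝ) (hμ : 0 < μ)
    (hε : ‖ε‖ ≤ (1 - lripConst A (2 * K)) ^ (3 / 2 : ℝ) * √μ / 3)
    (hσ : singVal X₀ K >
      (1 / (1 - lripConst A (2 * K)) + (1 - lripConst A (2 * K))) * √μ) :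
    ∃ X_B : Matrix (Fin n₁) (Fin n₂) 𝕜,
      bestRankSolutions A b K = {X_B} ∧
      globalMinimizers (regFunctional A b μ) = {X_B} ∧
      globalMinimizers (rankFunctional A b μ) = {X_B} ∧
      ‖X_B - X₀‖ ≤ 2 * ‖ε‖ / √(1 - lripConst A (2 * K)) ∧
      IsStationaryPt (regFunctional A b μ) X_B ∧
      ∀ X : Matrix (Fin n₁) (Fin n₂) 𝕜,
        IsStationaryPt (regFunctional A b μ) X → X ≠ X_B → K < X.rank := by
  set c := 1 - lripConst A (2 * K) with hcdef
  have hc : 0 < c := sub_pos.2 hδ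
  obtain ⟨C, hC0, hC1, hC⟩ := exists_contraction_const hA
  have hAle : ∀ X, ‖A X‖ ≤ ‖X‖ := fun X =>
    (hC X).trans (mul_le_of_le_one_left (norm_nonneg _) hC1.le)
  have hAlt : ∀ X, ‖X‖ ≤ 1 → ‖A X‖ < 1 := fun X hX =>
    ((hC X).trans (mul_le_of_le_one_right hC0 hX)).trans_lt hC1
  have hrip : ∀ X : Matrix (Fin n₁) (Fin n₂) 𝕜, X.rank ≤ 2 * K → c * ‖X‖ ^ 2 ≤ ‖A X‖ ^ 2 :=
    fun X hX => lripConst_mul_norm_sq_le A hX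
  have hX₀pos : 0 < ‖X₀‖ := by
    refine norm_pos_iff.2 fun h => ?_
    rw [h, Matrix.rank_zero] at hX₀
    omega
  -- X₀ ≠ 0 serves as a test matrix: c ≤ ‖AX₀‖²/‖X₀‖² ≤ C² < 1.
  have hc1 : c < 1 := by
    have h1 := (hrip X₀ (by omega)).trans (pow_le_pow_left₀ (norm_nonneg _) (hC X₀) 2)
    rw [mul_pow] at h1
    have h2 := le_of_mul_le_mul_right h1 (by positivity)
    exact h2.trans_lt (pow_lt_one₀ hC0 hC1 two_ne_zero)
  have hs0 : 0 < √c := Real.sqrt_pos.2 hc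
  have ha0 : 0 < √μ := Real.sqrt_pos.2 hμ
  have hpow : c ^ (3 / 2 : ℝ) = c * √c := by
    rw [show (3 / 2 : ℝ) = 1 + 1 / 2 by norm_num, Real.rpow_add hc, Real.rpow_one,
      Real.sqrt_eq_rpow]
  rw [hpow] at hε
  have hε0 : 0 ≤ ‖ε‖ := norm_nonneg ε
  have hbest_res : ∀ {X}, X ∈ bestRankSolutions A b K → ‖A X - b‖ ≤ ‖ε‖ := fun {X} hX => by
    have h := hX.2 X₀ hX₀.le
    rwa [hb, sub_add_cancel_left, norm_neg, ← hb] at h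
  have hbest_dist : ∀ {X}, X ∈ bestRankSolutions A b K → ‖X - X₀‖ ≤ 2 * ‖ε‖ / √c := by
    intro X hX
    rw [le_div_iff₀ hs0]
    have h1 : ‖A (X - X₀)‖ ≤ 2 * ‖ε‖ := by
      rw [map_sub, show A X - A X₀ = (A X - b) + ε by rw [hb]; abel]
      linarith [norm_add_le (A X - b) ε, hbest_res hX]
    refine le_trans (le_of_sq_le_sq ?_ (norm_nonneg _)) h1
    rw [mul_pow, Real.sq_sqrt hc.le, mul_comm]
    refine hrip _ ((Matrix.rank_sub_le_add _ _).trans ?_)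
    have := hX.1
    omega
  obtain ⟨B, hB⟩ := exists_mem_bestRankSolutions A b hc hrip
  -- Written with K because only rank B ≤ K is known here; m therefore bounds the rank functional at
  -- B from above.
  set m := μ * K + ‖A B - b‖ ^ 2 with hm
  have hne : ∀ {Y}, Y.rank ≠ K → m < rankFunctional A b μ Y := fun {Y} hY => by
    refine lt_of_le_of_lt ?_ (lt_rankFunctional_of_rank_ne hb hK hX₀ hμ hc hc1 hrip hε hσ hY)
    rw [hm]
    gcongr
    exact hbest_res hB
  have hmin : ∀ Y, m ≤ rankFunctional A b μ Y := fun Y => by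
    by_cases hY : Y.rank = K
    · rw [hm, rankFunctional, hY]
      gcongr
      exact hB.2 Y hY.le
    · exact (hne hY).le
  have hminreg : ∀ Y, m ≤ regFunctional A b μ Y := fun Y => by
    rcases rankFunctional_le_or_exists_lt A b hμ hAlt Y with h | ⟨Z, h⟩
    · exact (hmin Y).trans h
    · exact (hmin Z).trans h.le
  have hglob : ∀ {X}, rankFunctional A b μ X ≤ m → X ∈ globalMinimizers (regFunctional A b μ) :=
    fun {X} hX Y => ((regFunctional_le_rankFunctional A b hμ X).trans hX).trans (hminreg Y)
  have hbestm : ∀ {X}, X ∈ bestRankSolutions A b K → rankFunctional A b μ X ≤ m := by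
    intro X hX
    rw [hm, rankFunctional]
    gcongr
    · exact hX.1
    · exact hX.2 B hB.1
  have hBm := hbestm hB
  have hBglob := hglob hBm
  -- This c' satisfies 1/c' = 1/c + c/3, the factor left after σ_K(X₀) > (1/c + c)√μ loses ‖B - X₀‖
  -- ≤ (2/3)c√μ.
  have hc' : 0 < 3 * c / (3 + c ^ 2) := by positivity
  have hcc : 3 * c / (3 + c ^ 2) < c := by
    rw [div_lt_iff₀ (by positivity)]
    nlinarith [pow_pos hc 3]
  have hres : ‖b - A B‖ ≤ 3 * c / (3 + c ^ 2) * √μ := by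
    rw [norm_sub_rev]
    refine (hbest_res hB).trans (hε.trans ?_)
    have hs1 : √c ≤ 1 := Real.sqrt_le_one.2 hc1.le
    have h1 : c * √c / 3 ≤ 3 * c / (3 + c ^ 2) := by
      rw [div_le_div_iff₀ (by norm_num) (by positivity)]
      have h2 : c * √c ≤ c := mul_le_of_le_one_right hc.le hs1
      have h3 : c ^ 2 ≤ 1 := pow_le_one₀ hc.le hc1.le
      nlinarith [mul_le_mul h2 (by linarith : 3 + c ^ 2 ≤ 4) (by positivity) hc.le]
    calc c * √c * √μ / 3 = c * √c / 3 * √μ := by ring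
      _ ≤ _ := by gcongr
  have hgap : ∀ i : ℕ, (Matrix.toEuclideanLin B).singularValues i = 0 ∨
      √μ ≤ 3 * c / (3 + c ^ 2) * (Matrix.toEuclideanLin B).singularValues i := by
    intro i
    by_cases hi : (Matrix.toEuclideanLin B).singularValues i = 0
    · exact Or.inl hi
    · right
      have h1 := singVal_le_norm_sub_add_singularValue X₀ B hK hX₀ hB.1 i hi
      have h2 := hbest_dist hB
      have h3 : 2 * ‖ε‖ / √c ≤ 2 / 3 * c * √μ := by
        rw [div_le_iff₀ hs0]
        linarith
      have h4 : (1 / c + c / 3) * √μ ≤ (Matrix.toEuclideanLin B).singularValues i := by linarith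
      calc √μ = 3 * c / (3 + c ^ 2) * ((1 / c + c / 3) * √μ) := by
            field_simp
        _ ≤ _ := by gcongr
  have huniq : ∀ X, IsStationaryPt (regFunctional A b μ) X → X.rank ≤ K → X = B :=
    fun X hX hXK => hX.eq_of_best hμ hAle hc' hcc hc1.le hrip hB hres hgap hXK
  have huniqglob : ∀ X ∈ globalMinimizers (regFunctional A b μ), X = B := by
    intro X hX
    refine huniq X (isStationaryPt_of_mem_globalMinimizers hX) ?_
    have hXm : regFunctional A b μ X ≤ m :=
      (hX B).trans ((regFunctional_le_rankFunctional A b hμ B).trans hBm)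
    -- A minimizer must be in the first case: its rank functional is then at most m, which forces
    -- rank K.
    rcases rankFunctional_le_or_exists_lt A b hμ hAlt X with h | ⟨Z, h⟩
    · by_contra hK'
      exact absurd (h.trans hXm) (not_le.2 (hne (by omega)))
    · exact absurd (h.trans_le hXm) (not_lt.2 (hmin Z))
  refine ⟨B, ?_, ?_, ?_, hbest_dist hB, isStationaryPt_of_mem_globalMinimizers hBglob, ?_⟩
  · exact Set.eq_singleton_iff_unique_mem.2 ⟨hB, fun X hX => huniqglob X (hglob (hbestm hX))⟩
  · exact Set.eq_singleton_iff_unique_mem.2 ⟨hBglob, huniqglob⟩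
  · exact Set.eq_singleton_iff_unique_mem.2
      ⟨fun Y => hBm.trans (hmin Y), fun X hX => huniqglob X (hglob ((hX B).trans hBm))⟩
  · intro X hX hXB
    by_contra hK'
    exact hXB (huniq X hX (not_lt.1 hK'))
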